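/- Let $\mathbb C[G_1,\dots,G_n]$ carry a first class polynomial Poisson bracket: a Lie bracket $[\cdot,\cdot]$ which is a derivation in each argument and for which the polynomials $C_{ab}(G)=[G_a,G_b]$ have no constant term. Let $\mathcal A=\mathbb C(\mathcal P_a)\otimes\mathbb C(G_a)\otimes\mathbb C(\eta^a)$ be the algebra of polynomials in the commuting variables $G_a$ and the $2n$ mutually anticommuting variables $\mathcal P_a,\eta^a$, with the graded Poisson bracket determined by $[G_a,G_b]=C_{ab}(G)$, $[\mathcal P_a,\eta^b]=[\eta^b,\mathcal P_a]=-\delta_a{}^b$ (all other brackets of generators vanish) and with ghost number $\mathrm{gh}\,\eta^a=-\mathrm{gh}\,\mathcal P_a=1$, $\mathrm{gh}\,G_a=0$. A BRST generator is an element $\Omega\in\mathcal A$ of ghost number $1$ with $[\Omega,\Omega]=0$ and $\Omega=\sum_a G_a\eta^a+{}$terms containing at least one $\mathcal P_a$. Put $$C^a{}_{bc}=\left.\frac{\partial C_{bc}}{\partial G_a}\right|_{G=0},$$ and let $s'$ be the odd derivation of the algebra $\mathbb C(\eta^a)$ of polynomials in the anticommuting variables $\eta^a$ with $s'\eta^a=\tfrac12\sum_{b,c}C^a{}_{bc}\eta^b\eta^c$.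 The bracket $[e_b,e_c]=\sum_a C^a{}_{bc}e_a$ makes $\mathbb C^n$ a Lie algebra $\mathfrak g$ (the underlying Lie algebra). Then: 1. A BRST generator exists. 2. $s'^2=0$. 3. For every BRST generator $\Omega$, the map $s\,x=[x,\Omega]$ satisfies $s^2=0$, and there is a linear isomorphism from the cohomology $\ker s/\operatorname{im}s$ of $s$ in $\mathcal A$ to the cohomology $\ker s'/\operatorname{im}s'$ of $s'$ in $\mathbb C(\eta^a)$ that maps, for every $g\in\mathbb Z$, the classes of ghost number $g$ onto the classes of ghost number $g$ (degree $g$ in the $\eta^a$). 4. For every $k\ge 0$, the cohomology of $s'$ in degree $k$ is isomorphic to the Chevalley–Eilenberg cohomology $H^k(\mathfrak g,\mathbb C)$ of $\mathfrak g$ with trivial coefficients. -/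

import Mathlib

open scoped TensorProduct

noncomputable section

namespace PoissonBRST

/-! ## First class polynomial Poisson algebras -/

/-- A first class polynomial Poisson algebra on `n` independent commuting generators
`G_a = X a`: a Lie bracket on `ℂ[G_1, …, G_n]` that is a derivation in each argument and
for which the polynomials `C_{ab}(G) = [G_a, G_b]` have no constant term. -/
structure FirstClassPoissonAlgebra (n : ℕ) where
  /-- the Poisson bracket -/
  bracket : MvPolynomial (Fin n) ℂ →ₗ[ℂ] MvPolynomial (Fin n) ℂ →ₗ[ℂ] MvPolynomial (Fin n) ℂ
  bracket_self : ∀ f, bracket f f = 0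
  jacobi : ∀ f g h,
    bracket f (bracket g h) + bracket g (bracket h f) + bracket h (bracket f g) = 0
  leibniz : ∀ f g h, bracket (f * g) h = f * bracket g h + bracket f h * g
  firstClass : ∀ a b,
    MvPolynomial.constantCoeff (bracket (MvPolynomial.X a) (MvPolynomial.X b)) = 0

variable {n : ℕ}

/-- The polynomial `C_{ab}(G) = [G_a, G_b]`. -/
def FirstClassPoissonAlgebra.C (A : FirstClassPoissonAlgebra n) (a b : Fin n) :
    MvPolynomial (Fin n) ℂ :=
  A.bracket (MvPolynomial.X a) (MvPolynomial.X b)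

/-- The number `C^a_{bc}`, the value of `∂C_{bc}/∂G_a` at `G = 0`. -/
def FirstClassPoissonAlgebra.structConst (A : FirstClassPoissonAlgebra n) (a b c : Fin n) : ℂ :=
  MvPolynomial.eval 0 (MvPolynomial.pderiv a (A.C b c))

/-! ## The extended algebra of polynomials in `𝒫_a`, `G_a`, `η^a` -/

/-- The exterior algebra on the `2n` anticommuting variables `𝒫_a` (index `Sum.inl a`) and
`η^a` (index `Sum.inr a`). -/
abbrev GhostAlg (n : ℕ) : Type := ExteriorAlgebra ℂ (Fin n ⊕ Fin n → ℂ)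

/-- The algebra `ℂ(𝒫_a) ⊗ ℂ(G_a) ⊗ ℂ(η^a)` of polynomials in the commuting variables `G_a` and
the mutually anticommuting variables `𝒫_a`, `η^a`. -/
abbrev ExtAlg (n : ℕ) : Type := MvPolynomial (Fin n) ℂ ⊗[ℂ] GhostAlg n

/-- A polynomial in the `G_a` as an element of the extended algebra. -/
def ofPoly (f : MvPolynomial (Fin n) ℂ) : ExtAlg n := f ⊗ₜ[ℂ] 1

/-- The anticommuting variable with index `i`. -/
def ghostVar (i : Fin n ⊕ Fin n) : ExtAlg n :=
  1 ⊗ₜ[ℂ] ExteriorAlgebra.ι ℂ (Pi.single i 1)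

/-- The generator `G_a`. -/
def genG (a : Fin n) : ExtAlg n := ofPoly (MvPolynomial.X a)

/-- The ghost momentum `𝒫_a`. -/
def ghostMom (a : Fin n) : ExtAlg n := ghostVar (Sum.inl a)

/-- The ghost `η^a`. -/
def ghost (a : Fin n) : ExtAlg n := ghostVar (Sum.inr a)

/-- The partial derivative `∂/∂G_a` of the extended algebra. -/
def dG (a : Fin n) : ExtAlg n →ₗ[ℂ] ExtAlg n :=
  (MvPolynomial.pderiv a : Derivation ℂ _ _).toLinearMap.rTensor (GhostAlg n)

/-- The left derivative with respect to the anticommuting variable with index `i`. -/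
def dLeft (i : Fin n ⊕ Fin n) : ExtAlg n →ₗ[ℂ] ExtAlg n :=
  (CliffordAlgebra.contractLeft (Q := (0 : QuadraticForm ℂ (Fin n ⊕ Fin n → ℂ)))
    (LinearMap.proj i)).lTensor (MvPolynomial (Fin n) ℂ)

/-- The right derivative with respect to the anticommuting variable with index `i`. -/
def dRight (i : Fin n ⊕ Fin n) : ExtAlg n →ₗ[ℂ] ExtAlg n :=
  ((CliffordAlgebra.contractRight (Q := (0 : QuadraticForm ℂ (Fin n ⊕ Fin n → ℂ)))).flip
    (LinearMap.proj i)).lTensor (MvPolynomial (Fin n) ℂ)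

/-- The graded Poisson bracket of the extended algebra, determined by
`[G_a, G_b] = C_{ab}(G)`, `[𝒫_a, η^b] = [η^b, 𝒫_a] = -δ_a^b` (all other brackets of generators
being zero) and the graded Leibniz rule. -/
def gradedBracket (A : FirstClassPoissonAlgebra n) : ExtAlg n →ₗ[ℂ] ExtAlg n →ₗ[ℂ] ExtAlg n :=
  LinearMap.mk₂ ℂ
    (fun x y =>
      (∑ a, ∑ b, dG a x * ofPoly (A.C a b) * dG b y)
      - ∑ a, (dRight (Sum.inr a) x * dLeft (Sum.inl a) y
          + dRight (Sum.inl a) x * dLeft (Sum.inr a) y))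
    (by
      intro x x' y
      simp only [map_add, add_mul, Finset.sum_add_distrib]
      abel)
    (by
      intro c x y
      simp only [map_smul, smul_mul_assoc, ← Finset.smul_sum, ← smul_add, ← smul_sub])
    (by
      intro x y y'
      simp only [map_add, mul_add, Finset.sum_add_distrib]
      abel)
    (by
      intro c x y
      simp only [map_smul, mul_smul_comm, ← Finset.smul_sum, ← smul_add, ← smul_sub])

/-- The span of the monomials containing exactly `k` ghost momenta `𝒫` and `l` ghosts `η^a`
(with coefficients that are polynomials in the `G_a`). -/
def bidegree (k l : ℕ) : Submodule ℂ (ExtAlg n) :=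
  Submodule.span ℂ
    {x | ∃ (f : MvPolynomial (Fin n) ℂ) (p : Fin k → Fin n) (q : Fin l → Fin n),
      x = ofPoly f * (List.ofFn fun i => ghostMom (p i)).prod
        * (List.ofFn fun j => ghost (q j)).prod}

/-- The elements of ghost number `g`, where `gh η^a = 1`, `gh 𝒫_a = -1`, `gh G_a = 0`. -/
def ghostNumber (g : ℤ) : Submodule ℂ (ExtAlg n) :=
  ⨆ (k : ℕ) (l : ℕ) (_ : (l : ℤ) - k = g), bidegree k l

/-- The span of the monomials containing at least one ghost momentum. -/
def positiveAntighost : Submodule ℂ (ExtAlg n) :=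
  ⨆ (k : ℕ) (l : ℕ) (_ : 1 ≤ k), bidegree k l

/-- `Ω` is a BRST generator of the Poisson algebra: it has ghost number one, is equal to
`G_a η^a` up to terms containing at least one ghost momentum, and satisfies `[Ω, Ω] = 0`. -/
structure IsBRSTGenerator (A : FirstClassPoissonAlgebra n) (Ω : ExtAlg n) : Prop where
  ghost_one : Ω ∈ ghostNumber (n := n) 1
  leading : Ω - ∑ a, genG a * ghost a ∈ positiveAntighost (n := n)
  nilpotent : gradedBracket A Ω Ω = 0

/-- The BRST derivation `s x = [x, Ω]` generated by `Ω`. -/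
def brst (A : FirstClassPoissonAlgebra n) (Ω : ExtAlg n) : ExtAlg n →ₗ[ℂ] ExtAlg n :=
  (gradedBracket A).flip Ω

/-! ## The differential `s'` on `ℂ(η^a)` -/

/-- The algebra `ℂ(η^a)` of polynomials in `n` anticommuting variables. -/
abbrev EtaAlg (n : ℕ) : Type := ExteriorAlgebra ℂ (Fin n → ℂ)

/-- The generator `η^a` of `ℂ(η^a)`. -/
def eta (a : Fin n) : EtaAlg n := ExteriorAlgebra.ι ℂ (Pi.single a 1)

/-- The odd derivation `s'` of `ℂ(η^a)` with `s' η^a = ½ C^a_{bc} η^b η^c`, that is,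
`s' = ½ C^a_{bc} η^b η^c ∂/∂η^a` with the left derivative `∂/∂η^a`. -/
def sPrime (A : FirstClassPoissonAlgebra n) : EtaAlg n →ₗ[ℂ] EtaAlg n :=
  ∑ a, ∑ b, ∑ c, ((1 / 2 : ℂ) * A.structConst a b c) •
    (LinearMap.mulLeft ℂ (eta b * eta c) ∘ₗ
      CliffordAlgebra.contractLeft (Q := (0 : QuadraticForm ℂ (Fin n → ℂ))) (LinearMap.proj a))

/-- The elements of ghost number `g` of `ℂ(η^a)`, where `gh η^a = 1`. -/
def etaGhostNumber (g : ℤ) : Submodule ℂ (EtaAlg n) :=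
  ⨆ (l : ℕ) (_ : (l : ℤ) = g), ⋀[ℂ]^l (Fin n → ℂ)

/-! ## Cohomology of a differential -/

section Cohomology

variable {V : Type*} [AddCommGroup V] [Module ℂ V]

/-- The cohomology `ker d / im d` of an endomorphism `d` with `d ∘ d = 0`. -/
abbrev Cohomology (d : V →ₗ[ℂ] V) : Type _ :=
  LinearMap.ker d ⧸ (LinearMap.range d).submoduleOf (LinearMap.ker d)

/-- The subspace of cohomology classes represented by a cocycle lying in the subspace `W`. If
`W` is the subspace of degree `g` for a grading such that `d` is homogeneous, this is the
cohomology in degree `g`. -/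
def cohomologyIn (d : V →ₗ[ℂ] V) (W : Submodule ℂ V) : Submodule ℂ (Cohomology d) :=
  (W.submoduleOf (LinearMap.ker d)).map
    ((LinearMap.range d).submoduleOf (LinearMap.ker d)).mkQ

end Cohomology

/-! ## Chevalley–Eilenberg cohomology with trivial coefficients -/

section ChevalleyEilenberg

variable {L : Type*} [LieRing L] [LieAlgebra ℂ L]

/-- The Lie bracket as a bilinear map. -/
def lieBilin : L →ₗ[ℂ] L →ₗ[ℂ] L :=
  LinearMap.mk₂ ℂ (fun x y => ⁅x, y⁆) add_lie smul_lie lie_add (fun c x y => lie_smul c x y)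

/-- The Chevalley–Eilenberg differential `Alt^k(L, ℂ) → Alt^{k+1}(L, ℂ)` with coefficients in the
trivial module. It vanishes for `k = 0`; for `k ≥ 1` it is written as an antisymmetrization, and
`ceDiff_succ_apply` shows that it is given by the usual formula. -/
def ceDiff : (k : ℕ) → (L [⋀^Fin k]→ₗ[ℂ] ℂ) →ₗ[ℂ] (L [⋀^Fin (k + 1)]→ₗ[ℂ] ℂ)
  | 0 => 0
  | k + 1 =>
    { toFun := fun ω => (-(1 / 2) : ℂ) •
        AlternatingMap.alternatizeUncurryFin (AlternatingMap.alternatizeUncurryFinLM ∘ₗ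
          LinearMap.compr₂ (lieBilin (L := L)) ω.curryLeft)
      map_add' := by
        intro ω ω'
        rw [← smul_add, ← AlternatingMap.alternatizeUncurryFin_add, ← LinearMap.comp_add]
        rfl
      map_smul' := by
        intro c ω
        rw [RingHom.id_apply, smul_comm c]
        congr 1
        rw [← AlternatingMap.alternatizeUncurryFin_smul, ← LinearMap.comp_smul]
        rfl }

/-- The usual formula
`(dω)(v_0, …) = ∑_{i < j} (-1)^{i+j} ω([v_i, v_j], v_0, …, v̂_i, …, v̂_j, …)`, where the pairs
`i < j` of indices are written as `i`, `j + 1` with `i ≤ j`. -/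
theorem ceDiff_succ_apply (k : ℕ) (ω : L [⋀^Fin (k + 1)]→ₗ[ℂ] ℂ) (v : Fin (k + 2) → L) :
    ceDiff (k + 1) ω v = ∑ i : Fin (k + 1), ∑ j ∈ Finset.Ici i,
      (-1 : ℂ) ^ ((i : ℕ) + ((j : ℕ) + 1)) *
        ω (Fin.cons ⁅v i.castSucc, v j.succ⁆ (j.removeNth (i.castSucc.removeNth v))) := by
  simp only [ceDiff, LinearMap.coe_mk, AddHom.coe_mk, AlternatingMap.smul_apply,
    AlternatingMap.alternatizeUncurryFin_alternatizeUncurryFinLM_comp_apply, Finset.smul_sum]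
  refine Finset.sum_congr rfl fun i _ => Finset.sum_congr rfl fun j _ => ?_
  have h : ∀ x y : L, (LinearMap.compr₂ (lieBilin (L := L)) ω.curryLeft) x y
      = ω.curryLeft ⁅x, y⁆ := fun x y => rfl
  rw [h, h, ← lie_skew (v j.succ) (v i.castSucc), map_neg]
  simp only [AlternatingMap.neg_apply, AlternatingMap.curryLeft_apply_apply, zsmul_eq_mul,
    smul_eq_mul, Matrix.vecCons]
  push_cast
  ring

/-- The coboundaries in degree `k`. -/
def ceCoboundaries : (k : ℕ) → Submodule ℂ (L [⋀^Fin k]→ₗ[ℂ] ℂ)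
  | 0 => ⊥
  | k + 1 => LinearMap.range (ceDiff (L := L) k)

variable (L) in
/-- The Chevalley–Eilenberg cohomology `H^k(L, ℂ)` of the Lie algebra `L` with trivial
coefficients. -/
abbrev CECohomology (k : ℕ) : Type _ :=
  LinearMap.ker (ceDiff (L := L) k) ⧸
    (ceCoboundaries (L := L) k).submoduleOf (LinearMap.ker (ceDiff (L := L) k))

end ChevalleyEilenberg

/-! ## The underlying Lie algebra -/

namespace FirstClassPoissonAlgebra

variable (A : FirstClassPoissonAlgebra n)

theorem bracket_skew (f g : MvPolynomial (Fin n) ℂ) : A.bracket f g = -A.bracket g f := by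
  have h := A.bracket_self (f + g)
  simp only [map_add, LinearMap.add_apply, A.bracket_self, zero_add, add_zero] at h
  exact eq_neg_of_add_eq_zero_right h

theorem structConst_self (a b : Fin n) : A.structConst a b b = 0 := by
  simp [structConst, C, A.bracket_self]

theorem structConst_skew (a b c : Fin n) : A.structConst a b c = -A.structConst a c b := by
  simp [structConst, C, A.bracket_skew (MvPolynomial.X b)]

theorem bracket_eq_sum_left (f g : MvPolynomial (Fin n) ℂ) :
    A.bracket f g = ∑ b, MvPolynomial.pderiv b f * A.bracket (MvPolynomial.X b) g := by
  let D : Derivation ℂ (MvPolynomial (Fin n) ℂ) (MvPolynomial (Fin n) ℂ) :=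
    Derivation.mk' (A.bracket.flip g) (by
      intro f h
      simp only [LinearMap.flip_apply, A.leibniz, smul_eq_mul]
      ring)
  have hsum : ∀ p, (∑ b, A.bracket (MvPolynomial.X b) g • MvPolynomial.pderiv b :
      Derivation ℂ (MvPolynomial (Fin n) ℂ) (MvPolynomial (Fin n) ℂ)) p =
        ∑ b, A.bracket (MvPolynomial.X b) g * MvPolynomial.pderiv b p := fun p => by
    rw [← Derivation.coeFnAddMonoidHom_apply, map_sum, Finset.sum_apply]
    rfl
  have h : D = ∑ b, A.bracket (MvPolynomial.X b) g • MvPolynomial.pderiv b := by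
    refine MvPolynomial.derivation_ext fun i => ?_
    rw [hsum, Finset.sum_eq_single i]
    · simp [D]
    · intro b _ hb
      simp [MvPolynomial.pderiv_X_of_ne hb.symm]
    · simp
  have h' := congrArg (fun E : Derivation ℂ _ _ => E f) h
  simp only [hsum] at h'
  rw [show A.bracket f g = D f from rfl, h']
  exact Finset.sum_congr rfl fun b _ => mul_comm _ _

theorem bracket_eq_sum (f g : MvPolynomial (Fin n) ℂ) :
    A.bracket f g =
      ∑ b, ∑ c, MvPolynomial.pderiv b f * MvPolynomial.pderiv c g * A.C b c := by
  rw [bracket_eq_sum_left]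
  refine Finset.sum_congr rfl fun b _ => ?_
  rw [bracket_skew, bracket_eq_sum_left, ← Finset.sum_neg_distrib, Finset.mul_sum]
  refine Finset.sum_congr rfl fun c _ => ?_
  rw [C, A.bracket_skew (MvPolynomial.X b)]
  ring

theorem eval_zero_C (b c : Fin n) : MvPolynomial.eval 0 (A.C b c) = 0 := by
  rw [MvPolynomial.eval_zero]
  exact A.firstClass b c

/-- The differential at `G = 0` takes the Poisson bracket to the bracket with structure
constants `C^a_{bc}`. -/
theorem eval_pderiv_bracket (a : Fin n) (f g : MvPolynomial (Fin n) ℂ) :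
    MvPolynomial.eval 0 (MvPolynomial.pderiv a (A.bracket f g)) =
      ∑ b, ∑ c, A.structConst a b c * MvPolynomial.eval 0 (MvPolynomial.pderiv b f) *
        MvPolynomial.eval 0 (MvPolynomial.pderiv c g) := by
  rw [bracket_eq_sum, map_sum, map_sum]
  refine Finset.sum_congr rfl fun b _ => ?_
  rw [map_sum, map_sum]
  refine Finset.sum_congr rfl fun c _ => ?_
  rw [Derivation.leibniz]
  simp only [smul_eq_mul, map_add, map_mul, eval_zero_C, zero_mul, add_zero, structConst]
  ring

/-- The Lie algebra underlying the Poisson algebra: `ℂ^n` with the Lie bracket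
`[e_b, e_c] = ∑_a C^a_{bc} e_a`. -/
def UnderlyingLie (_A : FirstClassPoissonAlgebra n) : Type := Fin n → ℂ

instance : AddCommGroup A.UnderlyingLie := inferInstanceAs (AddCommGroup (Fin n → ℂ))

instance : Module ℂ A.UnderlyingLie := inferInstanceAs (Module ℂ (Fin n → ℂ))

instance : Bracket A.UnderlyingLie A.UnderlyingLie where
  bracket x y := fun a => ∑ b, ∑ c, A.structConst a b c * x b * y c

theorem lie_apply (x y : A.UnderlyingLie) (a : Fin n) :
    (⁅x, y⁆ : A.UnderlyingLie) a = ∑ b, ∑ c, A.structConst a b c * x b * y c := rfl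

/-- The linear polynomial with coefficients `x`. -/
def linPoly (x : A.UnderlyingLie) : MvPolynomial (Fin n) ℂ :=
  ∑ b, MvPolynomial.C (x b) * MvPolynomial.X b

/-- The differential of a polynomial at `G = 0`. -/
def diffAtZero (f : MvPolynomial (Fin n) ℂ) : A.UnderlyingLie :=
  fun a => MvPolynomial.eval 0 (MvPolynomial.pderiv a f)

theorem diffAtZero_linPoly (x : A.UnderlyingLie) : A.diffAtZero (A.linPoly x) = x := by
  funext a
  rw [diffAtZero, linPoly, map_sum, map_sum, Finset.sum_eq_single a]
  · simp
  · intro b _ hb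
    simp [MvPolynomial.pderiv_X_of_ne hb]
  · simp

theorem diffAtZero_bracket (f g : MvPolynomial (Fin n) ℂ) :
    A.diffAtZero (A.bracket f g) = ⁅A.diffAtZero f, A.diffAtZero g⁆ := by
  funext a
  exact A.eval_pderiv_bracket a f g

theorem diffAtZero_add (f g : MvPolynomial (Fin n) ℂ) :
    A.diffAtZero (f + g) = A.diffAtZero f + A.diffAtZero g := by
  funext a
  change MvPolynomial.eval 0 (MvPolynomial.pderiv a (f + g)) =
    MvPolynomial.eval 0 (MvPolynomial.pderiv a f) + MvPolynomial.eval 0 (MvPolynomial.pderiv a g)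
  rw [map_add, map_add]

instance : LieRing A.UnderlyingLie where
  add_lie x y z := by
    funext a
    change (⁅x + y, z⁆ : A.UnderlyingLie) a
      = (⁅x, z⁆ : A.UnderlyingLie) a + (⁅y, z⁆ : A.UnderlyingLie) a
    simp only [lie_apply, ← Finset.sum_add_distrib]
    refine Finset.sum_congr rfl fun b _ => Finset.sum_congr rfl fun c _ => ?_
    rw [show (x + y) b = x b + y b from rfl]
    ring
  lie_add x y z := by
    funext a
    change (⁅x, y + z⁆ : A.UnderlyingLie) a
      = (⁅x, y⁆ : A.UnderlyingLie) a + (⁅x, z⁆ : A.UnderlyingLie) a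
    simp only [lie_apply, ← Finset.sum_add_distrib]
    refine Finset.sum_congr rfl fun b _ => Finset.sum_congr rfl fun c _ => ?_
    rw [show (y + z) c = y c + z c from rfl]
    ring
  lie_self x := by
    rw [← A.diffAtZero_linPoly x, ← diffAtZero_bracket, A.bracket_self]
    funext a
    change MvPolynomial.eval 0 (MvPolynomial.pderiv a 0) = 0
    simp
  leibniz_lie x y z := by
    rw [← A.diffAtZero_linPoly x, ← A.diffAtZero_linPoly y, ← A.diffAtZero_linPoly z]
    simp only [← diffAtZero_bracket, ← diffAtZero_add]
    congr 1
    set f := A.linPoly x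
    set g := A.linPoly y
    set h := A.linPoly z
    have hJ := A.jacobi f g h
    rw [A.bracket_skew h f, A.bracket_skew h (A.bracket f g), map_neg] at hJ
    linear_combination hJ

instance : LieAlgebra ℂ A.UnderlyingLie where
  lie_smul t x y := by
    funext a
    change (⁅x, t • y⁆ : A.UnderlyingLie) a = t * (⁅x, y⁆ : A.UnderlyingLie) a
    simp only [lie_apply, Finset.mul_sum]
    refine Finset.sum_congr rfl fun b _ => Finset.sum_congr rfl fun c _ => ?_
    rw [show (t • y) c = t * y c from rfl]
    ring

end FirstClassPoissonAlgebra

end PoissonBRST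

end

/-!
The bracket with an odd element `y` is an odd derivation whose square is `½ [·, [y, y]]`
(`two_smul_gradedBracket_gradedBracket`): both sides are derivations, so it is enough to compare
them on the generators, where the identity is the Jacobi identity for the polynomials `C_{ab}(G)`.
In particular `s² = 0` for every BRST generator, and `[[y, y], y] = 0` for every odd `y`.

Filter the extended algebra by the number of ghost momenta (`antighostGE`). The leading part of
`[·, Ω]` is, up to the grading automorphism, the Koszul differential `δ = G_a ∂/∂𝒫_a`
(`gradedBracket_add_koszul_mem`). With `h = 𝒫_a ∂/∂G_a` one has `δ h + h δ = E`, where `E` counts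
the `G_a` and the `𝒫_a`. On the kernel of the projection `π` that sets `G_a` and `𝒫_a` to zero, `E`
acts with positive eigenvalues, hence is inverted by polynomials in `E`, which commute with `δ`
(`exists_polynomial_euler_inverse`). So an element of `ker π` that is closed to leading order is
exact up to terms with more ghost momenta (`exists_primitive_step`). There are at most `n` ghost
momenta in a monomial, so the iteration of this step stops.

* Applied to `[Ω, Ω]`, which is closed because `[[Ω, Ω], Ω] = 0`, the iteration corrects
  `G_a η^a` to a BRST generator (`exists_isBRSTGenerator`).
* Applied to a cocycle of `s` in `ker π`, it shows that `ker π` is acyclic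
  (`IsBRSTGenerator.exists_primitive`).

The terms of `[Ω, Ω] = 0` that are linear in the `G_a` and free of ghost momenta determine the part
of `Ω` linear in the `𝒫_a` at `G = 0` (`IsBRSTGenerator.projEta_dLeft_inl`). It follows that
`π s = s' θ π`, where `θ` is the grading automorphism of `ℂ(η^a)`; the automorphism appears since
`s` acts as a derivation from the right and `s'` from the left. As `π` is surjective, `s² = 0` gives
`s'² = 0`, and as `ker π` is acyclic, `π` induces the isomorphism of cohomologies. The ghost number
is tracked by carrying graded subspaces through the perturbation step.

For the Chevalley–Eilenberg complex, an element `x` of degree `k` in the `η^a` is sent to the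
alternating form `(v_0, …, v_{k-1}) ↦ i_{v_{k-1}} ⋯ i_{v_0} x` on the underlying Lie algebra. This
is injective by Euler's formula `η^a ∂x/∂η^a = k x`, bijective by a comparison of dimensions, and
takes `s'` to the negative of the Chevalley–Eilenberg differential (`altForm_sPrime`).
-/

namespace PoissonBRST

variable {n : ℕ}

/-! ### Graded calculus on the extended algebra -/

section Clifford

open CliffordAlgebra

variable {V : Type*} [AddCommGroup V] [Module ℂ V] {Q : QuadraticForm ℂ V}

theorem contractLeft_involute (d : Module.Dual ℂ V) (x : CliffordAlgebra Q) :
    contractLeft d (involute x) = -involute (contractLeft d x) := by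
  induction x using left_induction with
  | algebraMap r => simp
  | add x y hx hy => simp only [map_add, hx, hy]; abel
  | ι_mul x v hx => simp [contractLeft_ι_mul, hx]

/-- The contraction is a graded derivation. -/
theorem contractLeft_mul (d : Module.Dual ℂ V) (x y : CliffordAlgebra Q) :
    contractLeft d (x * y) = contractLeft d x * y + involute x * contractLeft d y := by
  induction x using left_induction with
  | algebraMap r => simp [contractLeft_algebraMap_mul]
  | add x y hx hy => simp only [map_add, add_mul, hx, hy]; abel
  | ι_mul x v hx =>
    rw [mul_assoc, contractLeft_ι_mul, hx, contractLeft_ι_mul, map_mul, involute_ι]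
    simp only [mul_add, sub_mul, smul_mul_assoc, mul_assoc, neg_mul]
    abel

theorem contractRight_eq_involute (d : Module.Dual ℂ V) (x : CliffordAlgebra Q) :
    contractRight x d = involute (contractLeft d x) := by
  induction x using right_induction with
  | algebraMap r => simp
  | add x y hx hy => simp only [map_add, LinearMap.add_apply, hx, hy]
  | mul_ι v x hx =>
    rw [contractRight_mul_ι, hx, contractLeft_mul, contractLeft_ι, map_add, map_mul, map_mul,
      involute_involute, involute_ι, AlgHom.commutes, ← Algebra.commutes, ← Algebra.smul_def]
    simp only [mul_neg]
    abel

end Clifford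

/-- The grading automorphism of the exterior algebra of `V`, equal to `(-1)^k` in degree `k`. -/
noncomputable abbrev extInvolute (V : Type*) [AddCommGroup V] [Module ℂ V] :
    ExteriorAlgebra ℂ V →ₐ[ℂ] ExteriorAlgebra ℂ V :=
  CliffordAlgebra.involute (Q := (0 : QuadraticForm ℂ V))

/-- The left contraction with a linear form, as an operator on the exterior algebra. -/
noncomputable abbrev extContract {V : Type*} [AddCommGroup V] [Module ℂ V]
    (d : Module.Dual ℂ V) : ExteriorAlgebra ℂ V →ₗ[ℂ] ExteriorAlgebra ℂ V :=
  CliffordAlgebra.contractLeft (Q := (0 : QuadraticForm ℂ V)) d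

theorem extContract_ι_mul {V : Type*} [AddCommGroup V] [Module ℂ V] (d : Module.Dual ℂ V)
    (v : V) (x : ExteriorAlgebra ℂ V) :
    extContract d (ExteriorAlgebra.ι ℂ v * x)
      = d v • x - ExteriorAlgebra.ι ℂ v * extContract d x :=
  CliffordAlgebra.contractLeft_ι_mul d v x

theorem extContract_ι {V : Type*} [AddCommGroup V] [Module ℂ V] (d : Module.Dual ℂ V) (v : V) :
    extContract d (ExteriorAlgebra.ι ℂ v) = algebraMap ℂ _ (d v) :=
  CliffordAlgebra.contractLeft_ι _ d v

theorem extContract_one {V : Type*} [AddCommGroup V] [Module ℂ V] (d : Module.Dual ℂ V) :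
    extContract d (1 : ExteriorAlgebra ℂ V) = 0 :=
  CliffordAlgebra.contractLeft_one _ d

theorem extInvolute_ι {V : Type*} [AddCommGroup V] [Module ℂ V] (v : V) :
    extInvolute V (ExteriorAlgebra.ι ℂ v) = -ExteriorAlgebra.ι ℂ v :=
  CliffordAlgebra.involute_ι _

theorem extAlg_left_induction {V : Type*} [AddCommGroup V] [Module ℂ V]
    {P : ExteriorAlgebra ℂ V → Prop} (h₀ : ∀ r : ℂ, P (algebraMap ℂ _ r))
    (h_add : ∀ x y, P x → P y → P (x + y))
    (h_mul : ∀ x v, P x → P (ExteriorAlgebra.ι ℂ v * x)) : ∀ x, P x :=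
  CliffordAlgebra.left_induction (Q := (0 : QuadraticForm ℂ V)) h₀ h_add h_mul

/-- The negation and subtraction found by unification on the tensor product do not agree reducibly
with those of its ring structure; this local instance selects the ring structure. -/
noncomputable local instance instRingExtAlg : Ring (ExtAlg n) := Algebra.TensorProduct.instRing

/-- The grading automorphism of the extended algebra: the identity on polynomials in the `G_a`,
and `-1` on the anticommuting variables. -/
noncomputable def parity : ExtAlg n →ₐ[ℂ] ExtAlg n :=
  Algebra.TensorProduct.map (AlgHom.id ℂ _) (extInvolute _)

theorem parity_tmul (f : MvPolynomial (Fin n) ℂ) (w : GhostAlg n) :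
    parity (f ⊗ₜ[ℂ] w) = f ⊗ₜ[ℂ] extInvolute _ w := rfl

theorem dLeft_tmul (i : Fin n ⊕ Fin n) (f : MvPolynomial (Fin n) ℂ) (w : GhostAlg n) :
    dLeft i (f ⊗ₜ[ℂ] w) = f ⊗ₜ[ℂ] extContract (LinearMap.proj i) w := rfl

theorem dG_tmul (a : Fin n) (f : MvPolynomial (Fin n) ℂ) (w : GhostAlg n) :
    dG a (f ⊗ₜ[ℂ] w) = MvPolynomial.pderiv a f ⊗ₜ[ℂ] w := rfl

theorem ExtAlg.induction {P : ExtAlg n → Prop} (h₀ : ∀ f, P (ofPoly f))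
    (h_add : ∀ x y, P x → P y → P (x + y)) (h_mul : ∀ i x, P x → P (ghostVar i * x)) :
    ∀ x, P x := by
  have htmul : ∀ (f : MvPolynomial (Fin n) ℂ) (w : GhostAlg n), P (f ⊗ₜ w) := by
    intro f w
    induction w using extAlg_left_induction generalizing f with
    | h₀ r =>
      rw [Algebra.algebraMap_eq_smul_one, ← TensorProduct.smul_tmul]
      exact h₀ _
    | h_add x y hx hy => rw [TensorProduct.tmul_add]; exact h_add _ _ (hx f) (hy f)
    | h_mul w v hw =>
      have hv : f ⊗ₜ[ℂ] (ExteriorAlgebra.ι ℂ v * w)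
          = ∑ i, ghostVar i * ((v i • f) ⊗ₜ[ℂ] w : ExtAlg n) := by
        conv_lhs => rw [← Finset.univ_sum_single v]
        rw [map_sum, Finset.sum_mul, TensorProduct.tmul_sum]
        refine Finset.sum_congr rfl fun i _ => ?_
        rw [ghostVar, Algebra.TensorProduct.tmul_mul_tmul, one_mul, TensorProduct.smul_tmul,
          ← smul_mul_assoc, ← map_smul, ← Pi.single_smul, smul_eq_mul, mul_one]
      rw [hv]
      refine Finset.sum_induction _ P h_add ?_ fun i _ => h_mul i _ (hw _)
      have := h₀ 0
      rwa [ofPoly, TensorProduct.zero_tmul] at this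
  intro x
  induction x using TensorProduct.induction_on with
  | zero => simpa using htmul 0 0
  | tmul f w => exact htmul f w
  | add x y hx hy => exact h_add _ _ hx hy

theorem ofPoly_mul (f g : MvPolynomial (Fin n) ℂ) : ofPoly (f * g) = ofPoly f * ofPoly g := by
  simp [ofPoly]

theorem ofPoly_one : ofPoly (1 : MvPolynomial (Fin n) ℂ) = 1 := rfl

theorem ofPoly_add (f g : MvPolynomial (Fin n) ℂ) : ofPoly (f + g) = ofPoly f + ofPoly g := by
  simp [ofPoly, TensorProduct.add_tmul]

theorem ofPoly_neg (f : MvPolynomial (Fin n) ℂ) : ofPoly (-f) = -ofPoly f := by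
  simp [ofPoly, TensorProduct.neg_tmul]

theorem ofPoly_sum {ι : Type*} (s : Finset ι) (f : ι → MvPolynomial (Fin n) ℂ) :
    ofPoly (∑ i ∈ s, f i) = ∑ i ∈ s, ofPoly (f i) := by
  simp [ofPoly, TensorProduct.sum_tmul]

theorem ofPoly_comm (f : MvPolynomial (Fin n) ℂ) (x : ExtAlg n) :
    ofPoly f * x = x * ofPoly f := by
  induction x using TensorProduct.induction_on with
  | zero => simp
  | tmul g w => simp [ofPoly, mul_comm]
  | add x y hx hy => rw [mul_add, add_mul, hx, hy]

@[simp] theorem parity_ofPoly (f : MvPolynomial (Fin n) ℂ) : parity (ofPoly f) = ofPoly f := by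
  simp [ofPoly, parity_tmul]

@[simp] theorem parity_ghostVar (i : Fin n ⊕ Fin n) : parity (ghostVar i) = -ghostVar i := by
  rw [ghostVar, parity_tmul, extInvolute_ι, TensorProduct.tmul_neg]

@[simp] theorem parity_parity (x : ExtAlg n) : parity (parity x) = x := by
  induction x using TensorProduct.induction_on with
  | zero => simp
  | tmul f w => rw [parity_tmul, parity_tmul, show extInvolute _ (extInvolute _ w) = w from
      CliffordAlgebra.involute_involute w]
  | add x y hx hy => rw [map_add, map_add, hx, hy]

@[simp] theorem dG_ofPoly (a : Fin n) (f : MvPolynomial (Fin n) ℂ) :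
    dG a (ofPoly f) = ofPoly (MvPolynomial.pderiv a f) := rfl

@[simp] theorem dG_ghostVar (a : Fin n) (i : Fin n ⊕ Fin n) : dG a (ghostVar i) = 0 := by
  rw [ghostVar, dG_tmul, Derivation.map_one_eq_zero, TensorProduct.zero_tmul]

@[simp] theorem dLeft_ofPoly (i : Fin n ⊕ Fin n) (f : MvPolynomial (Fin n) ℂ) :
    dLeft i (ofPoly f) = 0 := by
  rw [ofPoly, dLeft_tmul]
  erw [extContract_one]
  rw [TensorProduct.tmul_zero]

theorem dLeft_ghostVar (i j : Fin n ⊕ Fin n) :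
    dLeft i (ghostVar j) = if i = j then 1 else 0 := by
  rw [ghostVar, dLeft_tmul]
  erw [extContract_ι]
  rw [LinearMap.proj_apply, Pi.single_apply]
  split_ifs
  · simp; rfl
  · simp

theorem dG_mul (a : Fin n) (x y : ExtAlg n) : dG a (x * y) = dG a x * y + x * dG a y := by
  induction x using TensorProduct.induction_on with
  | zero => simp
  | add x x' hx hx' => simp only [add_mul, map_add, hx, hx']; abel
  | tmul f w =>
    induction y using TensorProduct.induction_on with
    | zero => simp
    | add y y' hy hy' => simp only [mul_add, map_add, hy, hy']; abel
    | tmul g v =>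
      simp only [Algebra.TensorProduct.tmul_mul_tmul, dG_tmul, Derivation.leibniz,
        TensorProduct.add_tmul, smul_eq_mul]
      rw [add_comm, mul_comm g]

theorem dLeft_mul (i : Fin n ⊕ Fin n) (x y : ExtAlg n) :
    dLeft i (x * y) = dLeft i x * y + parity x * dLeft i y := by
  induction x using TensorProduct.induction_on with
  | zero => simp
  | add x x' hx hx' => simp only [add_mul, map_add, hx, hx']; abel
  | tmul f w =>
    induction y using TensorProduct.induction_on with
    | zero => simp
    | add y y' hy hy' => simp only [mul_add, map_add, hy, hy']; abel
    | tmul g v =>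
      have h : ∀ d x y, extContract (V := Fin n ⊕ Fin n → ℂ) d (x * y)
          = extContract d x * y + extInvolute _ x * extContract d y := contractLeft_mul
      simp only [Algebra.TensorProduct.tmul_mul_tmul, dLeft_tmul, h, TensorProduct.tmul_add,
        parity_tmul]

theorem dRight_eq (i : Fin n ⊕ Fin n) (x : ExtAlg n) : dRight i x = parity (dLeft i x) := by
  induction x using TensorProduct.induction_on with
  | zero => simp
  | add x x' hx hx' => simp only [map_add, hx, hx']
  | tmul f w =>
    rw [dLeft_tmul, parity_tmul,
      ← show CliffordAlgebra.contractRight _ _ = _ from contractRight_eq_involute _ w]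
    rfl

theorem dLeft_parity (i : Fin n ⊕ Fin n) (x : ExtAlg n) :
    dLeft i (parity x) = -parity (dLeft i x) := by
  induction x using TensorProduct.induction_on with
  | zero => simp
  | add x x' hx hx' => simp only [map_add, hx, hx']; abel
  | tmul f w =>
    rw [dLeft_tmul, parity_tmul, dLeft_tmul, parity_tmul,
      show extContract _ (extInvolute _ w) = _ from contractLeft_involute _ w,
      TensorProduct.tmul_neg]

theorem dG_parity (a : Fin n) (x : ExtAlg n) : dG a (parity x) = parity (dG a x) := by
  induction x using TensorProduct.induction_on with
  | zero => simp
  | add x x' hx hx' => simp only [map_add, hx, hx']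
  | tmul f w => rfl

theorem dLeft_dG (i : Fin n ⊕ Fin n) (a : Fin n) (x : ExtAlg n) :
    dLeft i (dG a x) = dG a (dLeft i x) := by
  induction x using TensorProduct.induction_on with
  | zero => simp
  | add x x' hx hx' => simp only [map_add, hx, hx']
  | tmul f w => rfl

theorem pderiv_pderiv_comm (a b : Fin n) (f : MvPolynomial (Fin n) ℂ) :
    MvPolynomial.pderiv a (MvPolynomial.pderiv b f)
      = MvPolynomial.pderiv b (MvPolynomial.pderiv a f) := by
  have h : ⁅MvPolynomial.pderiv (R := ℂ) a, MvPolynomial.pderiv (R := ℂ) b⁆ = 0 := by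
    refine MvPolynomial.derivation_ext fun i => ?_
    rw [Derivation.commutator_apply, MvPolynomial.pderiv_X, MvPolynomial.pderiv_X]
    simp only [Pi.single_apply]
    split_ifs <;> simp
  have h' := DFunLike.congr_fun h f
  rw [Derivation.commutator_apply] at h'
  exact sub_eq_zero.mp h'

theorem dG_comm (a b : Fin n) (x : ExtAlg n) : dG a (dG b x) = dG b (dG a x) := by
  induction x using TensorProduct.induction_on with
  | zero => simp
  | add x x' hx hx' => simp only [map_add, hx, hx']
  | tmul f w => rw [dG_tmul, dG_tmul, dG_tmul, dG_tmul, pderiv_pderiv_comm]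

theorem dLeft_comm (i j : Fin n ⊕ Fin n) (x : ExtAlg n) :
    dLeft i (dLeft j x) = -dLeft j (dLeft i x) := by
  induction x using TensorProduct.induction_on with
  | zero => simp
  | add x x' hx hx' => simp only [map_add, hx, hx']; abel
  | tmul f w =>
    rw [dLeft_tmul, dLeft_tmul, dLeft_tmul, dLeft_tmul]
    erw [CliffordAlgebra.contractLeft_comm]
    rw [TensorProduct.tmul_neg]

theorem ghostVar_mul (i : Fin n ⊕ Fin n) (x : ExtAlg n) :
    ghostVar i * x = parity x * ghostVar i := by
  induction x using ExtAlg.induction with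
  | h₀ f => rw [parity_ofPoly, ofPoly_comm]
  | h_add x y hx hy => rw [mul_add, map_add, add_mul, hx, hy]
  | h_mul j x hx =>
    have h : ghostVar i * ghostVar j = -(ghostVar j * ghostVar i) := by
      rw [eq_neg_iff_add_eq_zero]
      simp only [ghostVar, Algebra.TensorProduct.tmul_mul_tmul, ← TensorProduct.tmul_add,
        ExteriorAlgebra.ι_add_mul_swap, TensorProduct.tmul_zero]
    rw [← mul_assoc, h, map_mul, parity_ghostVar, neg_mul, mul_assoc, hx]
    simp only [neg_mul, mul_assoc]

/-- Graded commutativity: `x + parity x` and `x - parity x` are twice the even and the odd component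
of `x`. -/
theorem even_odd_part_comm (x : ExtAlg n) :
    (∀ y, (x + parity x) * y = y * (x + parity x)) ∧
      ∀ y, (x - parity x) * y = parity y * (x - parity x) := by
  induction x using ExtAlg.induction with
  | h₀ f =>
    refine ⟨fun y => ?_, fun y => by simp⟩
    simp only [parity_ofPoly, add_mul, mul_add, ofPoly_comm f y]
  | h_add x x' hx hx' =>
    refine ⟨fun y => ?_, fun y => ?_⟩
    · rw [map_add, add_add_add_comm, add_mul, mul_add, hx.1, hx'.1]
    · rw [map_add, add_sub_add_comm, add_mul, mul_add, hx.2, hx'.2]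
  | h_mul i x hx =>
    refine ⟨fun y => ?_, fun y => ?_⟩
    · rw [map_mul, parity_ghostVar, neg_mul, ← sub_eq_add_neg, ← mul_sub, mul_assoc, hx.2,
        ← mul_assoc, ghostVar_mul, parity_parity, mul_assoc]
    · rw [map_mul, parity_ghostVar, neg_mul, sub_neg_eq_add, ← mul_add, mul_assoc, hx.1,
        ← mul_assoc, ghostVar_mul, mul_assoc]

/-- An even element is central. -/
theorem even_mul_comm {x : ExtAlg n} (hx : parity x = x) (y : ExtAlg n) : x * y = y * x := by
  have h := (even_odd_part_comm x).1 y
  rw [hx, ← two_smul ℂ x, smul_mul_assoc, mul_smul_comm] at h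
  exact (smul_right_injective _ (two_ne_zero (α := ℂ))) h

theorem odd_mul_comm {x : ExtAlg n} (hx : parity x = -x) (y : ExtAlg n) :
    x * y = parity y * x := by
  have h := (even_odd_part_comm x).2 y
  rw [hx, sub_neg_eq_add, ← two_smul ℂ x, smul_mul_assoc, mul_smul_comm] at h
  exact (smul_right_injective _ (two_ne_zero (α := ℂ))) h

/-! ### The graded Poisson bracket -/

/-- The bracket `[G_a, y]`. -/
noncomputable def bracketG (A : FirstClassPoissonAlgebra n) (a : Fin n) (y : ExtAlg n) :
    ExtAlg n := ∑ b, ofPoly (A.C a b) * dG b y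

variable (A : FirstClassPoissonAlgebra n)

theorem gradedBracket_apply (x y : ExtAlg n) :
    gradedBracket A x y = ∑ a, dG a x * bracketG A a y
      - ∑ i : Fin n ⊕ Fin n, parity (dLeft i x) * dLeft i.swap y := by
  have h : gradedBracket A x y = (∑ a, ∑ b, dG a x * ofPoly (A.C a b) * dG b y)
      - ∑ a, (dRight (Sum.inr a) x * dLeft (Sum.inl a) y
          + dRight (Sum.inl a) x * dLeft (Sum.inr a) y) := rfl
  rw [h, Fintype.sum_sum_type, Finset.sum_add_distrib]
  simp only [dRight_eq, bracketG, Finset.mul_sum, mul_assoc, Sum.swap_inl, Sum.swap_inr]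
  abel

theorem parity_bracketG (a : Fin n) (y : ExtAlg n) :
    parity (bracketG A a y) = bracketG A a (parity y) := by
  simp [bracketG, map_sum, dG_parity]

theorem bracketG_neg (a : Fin n) (y : ExtAlg n) :
    bracketG A a (-y) = -bracketG A a y := by
  simp [bracketG]

theorem parity_gradedBracket (x y : ExtAlg n) :
    parity (gradedBracket A x y) = gradedBracket A (parity x) (parity y) := by
  simp only [gradedBracket_apply, map_sub, map_sum, map_mul, parity_bracketG, dG_parity,
    dLeft_parity, map_neg, neg_mul, mul_neg, neg_neg]

theorem C_skew (a b : Fin n) : A.C a b = -A.C b a := A.bracket_skew _ _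

section Odd

variable {x y : ExtAlg n}

theorem parity_dLeft_of_odd (hx : parity x = -x) (i : Fin n ⊕ Fin n) :
    parity (dLeft i x) = dLeft i x := by
  have h := dLeft_parity i x
  rw [hx, map_neg] at h
  exact (neg_injective h).symm

theorem parity_dLeft_of_even (hx : parity x = x) (i : Fin n ⊕ Fin n) :
    parity (dLeft i x) = -dLeft i x := by
  have h := dLeft_parity i x
  rw [hx] at h
  exact neg_eq_iff_eq_neg.mp h.symm

theorem parity_dG_of_odd (hx : parity x = -x) (a : Fin n) : parity (dG a x) = -dG a x := by
  rw [← dG_parity, hx, map_neg]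

theorem parity_dG_of_even (hx : parity x = x) (a : Fin n) : parity (dG a x) = dG a x := by
  rw [← dG_parity, hx]

theorem odd_mul_self_comm (hx : parity x = -x) (hy : parity y = -y) : x * y = -(y * x) := by
  rw [odd_mul_comm hx, hy, neg_mul]

/-- The bracket with an odd element is an odd derivation acting from the right. -/
theorem gradedBracket_mul_of_odd (hy : parity y = -y) (x x' : ExtAlg n) :
    gradedBracket A (x * x') y
      = x * gradedBracket A x' y + gradedBracket A x y * parity x' := by
  simp only [gradedBracket_apply, dG_mul, dLeft_mul, add_mul, mul_sub, sub_mul, Finset.mul_sum,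
    Finset.sum_mul, Finset.sum_add_distrib, map_add, map_mul, parity_parity]
  have h₁ : ∀ a, dG a x * x' * bracketG A a y = dG a x * bracketG A a y * parity x' := fun a => by
    have h : parity (bracketG A a y) = -bracketG A a y := by
      rw [parity_bracketG, hy, bracketG_neg]
    rw [mul_assoc, mul_assoc, odd_mul_comm h, parity_parity]
  have h₂ : ∀ i, parity (dLeft i x) * parity x' * dLeft i.swap y
      = parity (dLeft i x) * dLeft i.swap y * parity x' := fun i => by
    rw [mul_assoc, mul_assoc, even_mul_comm (parity_dLeft_of_odd hy _)]
  simp only [h₁, h₂, mul_assoc]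
  abel

/-- The bracket with an even element is a derivation. -/
theorem gradedBracket_mul_of_even (hy : parity y = y) (x x' : ExtAlg n) :
    gradedBracket A (x * x') y
      = x * gradedBracket A x' y + gradedBracket A x y * x' := by
  simp only [gradedBracket_apply, dG_mul, dLeft_mul, add_mul, mul_sub, sub_mul, Finset.mul_sum,
    Finset.sum_mul, Finset.sum_add_distrib, map_add, map_mul, parity_parity]
  have h₁ : ∀ a, dG a x * x' * bracketG A a y = dG a x * bracketG A a y * x' := fun a => by
    have h : parity (bracketG A a y) = bracketG A a y := by rw [parity_bracketG, hy]
    rw [mul_assoc, mul_assoc, even_mul_comm h]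
  have h₂ : ∀ i, parity (dLeft i x) * parity x' * dLeft i.swap y
      = parity (dLeft i x) * dLeft i.swap y * x' := fun i => by
    have h : parity (dLeft i.swap y) = -dLeft i.swap y := parity_dLeft_of_even hy _
    rw [mul_assoc, mul_assoc, odd_mul_comm h]
  simp only [h₁, h₂, mul_assoc]
  abel

theorem sum_dG_mul_bracketG (x y : ExtAlg n) : ∑ a, dG a x * bracketG A a y
    = ∑ a, ∑ b, ofPoly (A.C a b) * (dG a x * dG b y) := by
  simp only [bracketG, Finset.mul_sum]
  refine Finset.sum_congr rfl fun a _ => Finset.sum_congr rfl fun b _ => ?_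
  rw [← mul_assoc, ← ofPoly_comm, mul_assoc]

theorem gradedBracket_symm_of_odd (hx : parity x = -x) (hy : parity y = -y) :
    gradedBracket A x y = gradedBracket A y x := by
  rw [gradedBracket_apply, gradedBracket_apply, sum_dG_mul_bracketG, sum_dG_mul_bracketG]
  congr 1
  · rw [Finset.sum_comm]
    refine Finset.sum_congr rfl fun a _ => Finset.sum_congr rfl fun b _ => ?_
    rw [C_skew, odd_mul_self_comm (parity_dG_of_odd hx _) (parity_dG_of_odd hy _), ofPoly_neg,
      neg_mul_neg]
  · rw [← Equiv.sum_comp (Equiv.sumComm (Fin n) (Fin n))]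
    refine Finset.sum_congr rfl fun i _ => ?_
    rw [Equiv.sumComm_apply, Sum.swap_swap, parity_dLeft_of_odd hx, parity_dLeft_of_odd hy,
      even_mul_comm (parity_dLeft_of_odd hx _)]

theorem gradedBracket_skew_of_odd_of_even (hx : parity x = -x) (hy : parity y = y) :
    gradedBracket A x y = -gradedBracket A y x := by
  rw [gradedBracket_apply, gradedBracket_apply, sum_dG_mul_bracketG, sum_dG_mul_bracketG, neg_sub',
    ← Finset.sum_neg_distrib, ← Finset.sum_neg_distrib]
  congr 1
  · rw [Finset.sum_comm]
    refine Finset.sum_congr rfl fun a _ => ?_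
    rw [← Finset.sum_neg_distrib]
    refine Finset.sum_congr rfl fun b _ => ?_
    rw [C_skew, ← even_mul_comm (parity_dG_of_even hy _), ofPoly_neg, neg_mul]
  · rw [← Equiv.sum_comp (Equiv.sumComm (Fin n) (Fin n))]
    refine Finset.sum_congr rfl fun i _ => ?_
    rw [Equiv.sumComm_apply, Sum.swap_swap, parity_dLeft_of_odd hx, parity_dLeft_of_even hy,
      even_mul_comm (parity_dLeft_of_odd hx _), neg_mul, neg_neg]

/-! ### The square of the BRST derivation -/

/-- This gives the square of `[·, x]` on an anticommuting generator, as the bracket with such a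
generator is a left derivative. -/
theorem dLeft_gradedBracket_self (hx : parity x = -x) (j : Fin n ⊕ Fin n) :
    dLeft j (gradedBracket A x x) = (2 : ℂ) • gradedBracket A (dLeft j x) x := by
  have hG : ∀ a, parity (dG a x) = -dG a x := parity_dG_of_odd hx
  have hL : ∀ i, parity (dLeft i x) = dLeft i x := parity_dLeft_of_odd hx
  have hGL : ∀ a, parity (dG a (dLeft j x)) = dG a (dLeft j x) := fun a => by
    rw [← dG_parity, hL]
  have hLL : ∀ i, parity (dLeft i (dLeft j x)) = dLeft j (dLeft i x) := fun i => by
    rw [parity_dLeft_of_even (hL j), dLeft_comm, neg_neg]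
  rw [gradedBracket_apply, gradedBracket_apply, sum_dG_mul_bracketG, sum_dG_mul_bracketG,
    two_smul, map_sub, map_sum, map_sum]
  simp only [map_sum, dLeft_mul, dLeft_ofPoly, zero_mul, zero_add, parity_ofPoly, dLeft_dG, hG, hL,
    hLL, mul_add, Finset.sum_add_distrib]
  have h₁ : ∑ a, ∑ b, ofPoly (A.C a b) * (-dG a x * dG b (dLeft j x))
      = ∑ a, ∑ b, ofPoly (A.C a b) * (dG a (dLeft j x) * dG b x) := by
    rw [Finset.sum_comm]
    refine Finset.sum_congr rfl fun a _ => Finset.sum_congr rfl fun b _ => ?_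
    rw [C_skew, ofPoly_neg, even_mul_comm (hGL a), neg_mul, neg_mul, mul_neg, neg_neg]
  have h₂ : ∑ i : Fin n ⊕ Fin n, dLeft i x * dLeft j (dLeft i.swap x)
      = ∑ i : Fin n ⊕ Fin n, dLeft j (dLeft i x) * dLeft i.swap x := by
    rw [← Equiv.sum_comp (Equiv.sumComm (Fin n) (Fin n))]
    refine Finset.sum_congr rfl fun i _ => ?_
    rw [Equiv.sumComm_apply, Sum.swap_swap, even_mul_comm (hL _)]
  rw [h₁, h₂]
  abel

theorem dG_gradedBracket_self (hx : parity x = -x) (c : Fin n) :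
    dG c (gradedBracket A x x) = (2 : ℂ) • gradedBracket A (dG c x) x
      + ∑ a, ∑ b, ofPoly (MvPolynomial.pderiv c (A.C a b)) * (dG a x * dG b x) := by
  have h := gradedBracket_symm_of_odd A (parity_dG_of_odd hx c) hx
  rw [two_smul]
  nth_rw 2 [h]
  simp only [gradedBracket_apply, sum_dG_mul_bracketG, map_sub, map_sum, dG_mul, dG_ofPoly,
    mul_add, Finset.sum_add_distrib, dLeft_dG, dG_parity]
  simp only [dG_comm _ c]
  abel

end Odd

theorem gradedBracket_ofPoly (f : MvPolynomial (Fin n) ℂ) (y : ExtAlg n) :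
    gradedBracket A (ofPoly f) y = ∑ a, ofPoly (MvPolynomial.pderiv a f) * bracketG A a y := by
  simp [gradedBracket_apply]

theorem gradedBracket_genG (a : Fin n) (y : ExtAlg n) :
    gradedBracket A (genG a) y = bracketG A a y := by
  rw [genG, gradedBracket_ofPoly, Finset.sum_eq_single a]
  · rw [MvPolynomial.pderiv_X_self, ofPoly_one, one_mul]
  · intro b _ hb
    rw [MvPolynomial.pderiv_X_of_ne hb.symm, ofPoly, TensorProduct.zero_tmul, zero_mul]
  · simp

theorem gradedBracket_ghostVar (i : Fin n ⊕ Fin n) (y : ExtAlg n) :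
    gradedBracket A (ghostVar i) y = -dLeft i.swap y := by
  rw [gradedBracket_apply, Finset.sum_eq_zero fun a _ => by rw [dG_ghostVar, zero_mul], zero_sub,
    Finset.sum_eq_single i]
  · rw [dLeft_ghostVar, if_pos rfl, map_one, one_mul]
  · intro j _ hj
    rw [dLeft_ghostVar, if_neg hj, map_zero, zero_mul]
  · simp

/-- The Jacobi identity of the Poisson bracket in coordinates. -/
theorem C_jacobi (c a d : Fin n) :
    ∑ b, (A.C c b * MvPolynomial.pderiv b (A.C a d) + A.C a b * MvPolynomial.pderiv b (A.C d c)
      + A.C d b * MvPolynomial.pderiv b (A.C c a)) = 0 := by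
  have h : ∀ a (f : MvPolynomial (Fin n) ℂ), A.bracket (MvPolynomial.X a) f
      = ∑ b, A.C a b * MvPolynomial.pderiv b f := fun a f => by
    rw [A.bracket_skew, A.bracket_eq_sum_left, ← Finset.sum_neg_distrib]
    refine Finset.sum_congr rfl fun b _ => ?_
    rw [FirstClassPoissonAlgebra.C, A.bracket_skew (MvPolynomial.X a)]
    ring
  rw [Finset.sum_add_distrib, Finset.sum_add_distrib, ← h, ← h, ← h]
  exact A.jacobi _ _ _

/-- On `G_c` the square of the derivation `[·, x]` is given by the Jacobi identity. -/
theorem gradedBracket_gradedBracket_genG {x : ExtAlg n} (hx : parity x = -x) (c : Fin n) :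
    (2 : ℂ) • gradedBracket A (gradedBracket A (genG c) x) x
      = gradedBracket A (genG c) (gradedBracket A x x) := by
  have hG : ∀ a, parity (dG a x) = -dG a x := parity_dG_of_odd hx
  have hcomm : ∀ a b, dG a x * dG b x = -(dG b x * dG a x) :=
    fun a b => odd_mul_self_comm (hG a) (hG b)
  rw [gradedBracket_genG, gradedBracket_genG, bracketG, bracketG, map_sum, LinearMap.sum_apply]
  simp only [gradedBracket_mul_of_odd A hx, dG_gradedBracket_self A hx, hG, gradedBracket_ofPoly,
    Finset.sum_add_distrib, smul_add, mul_add, mul_smul_comm, Finset.smul_sum]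
  refine congrArg₂ (· + ·) rfl ?_
  -- Both sides are sums of polynomials times `dG a x * dG d x`.
  let T : (Fin n → Fin n → MvPolynomial (Fin n) ℂ) → ExtAlg n := fun p =>
    ∑ a, ∑ d, ofPoly (p a d) * (dG a x * dG d x)
  have hT : ∀ p q, T (fun a d => q d a - p a d) = -(T q + T p) := fun p q => by
    have hq : ∑ a, ∑ d, ofPoly (q d a) * (dG a x * dG d x) = -T q := by
      rw [Finset.sum_comm, ← Finset.sum_neg_distrib]
      refine Finset.sum_congr rfl fun a _ => ?_
      rw [← Finset.sum_neg_distrib]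
      refine Finset.sum_congr rfl fun d _ => ?_
      rw [hcomm, mul_neg]
    simp only [T, sub_eq_add_neg, ofPoly_add, ofPoly_neg, add_mul, neg_mul, Finset.sum_add_distrib,
      Finset.sum_neg_distrib] at hq ⊢
    rw [hq, neg_add]
  let r : Fin n → Fin n → MvPolynomial (Fin n) ℂ := fun a d =>
    ∑ b, A.C d b * MvPolynomial.pderiv b (A.C c a)
  have h₁ : ∑ b, (∑ a, ofPoly (MvPolynomial.pderiv a (A.C c b)) * bracketG A a x) * -dG b x
      = -T r := by
    simp only [T, r, ofPoly_sum, Finset.sum_mul, bracketG, Finset.mul_sum,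
      ← Finset.sum_neg_distrib]
    refine Finset.sum_congr rfl fun a _ => ?_
    rw [Finset.sum_comm]
    refine Finset.sum_congr rfl fun d _ => Finset.sum_congr rfl fun b _ => ?_
    rw [C_skew A b d, hcomm a d, ← mul_assoc, ← ofPoly_mul, mul_neg,
      mul_comm (MvPolynomial.pderiv _ _), neg_mul, ofPoly_neg]
    simp only [neg_mul, mul_neg, neg_neg, mul_assoc]
  have h₂ : ∑ b, ofPoly (A.C c b) * (∑ a, ∑ d, ofPoly (MvPolynomial.pderiv b (A.C a d))
      * (dG a x * dG d x)) = -(T r + T r) := by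
    have hr : (fun a d => r d a - r a d)
        = fun a d => ∑ b, A.C c b * MvPolynomial.pderiv b (A.C a d) := by
      funext a d
      have h := C_jacobi A c a d
      simp only [C_skew A d c, map_neg, mul_neg, Finset.sum_add_distrib,
        Finset.sum_neg_distrib] at h
      simp only [r]
      linear_combination -h
    rw [← hT, hr]
    simp only [T, ofPoly_sum, Finset.sum_mul, Finset.mul_sum]
    rw [Finset.sum_comm]
    refine Finset.sum_congr rfl fun a _ => ?_
    rw [Finset.sum_comm]
    refine Finset.sum_congr rfl fun d _ => Finset.sum_congr rfl fun b _ => ?_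
    rw [ofPoly_mul, mul_assoc]
  rw [← Finset.smul_sum, h₁, h₂, two_smul, neg_add]

/-- The square of the odd derivation `[·, y]` is `½ [·, [y, y]]`. Both sides are derivations, which
reduces the identity to the generators. -/
theorem two_smul_gradedBracket_gradedBracket {y : ExtAlg n} (hy : parity y = -y) (x : ExtAlg n) :
    (2 : ℂ) • gradedBracket A (gradedBracket A x y) y
      = gradedBracket A x (gradedBracket A y y) := by
  have hR : parity (gradedBracket A y y) = gradedBracket A y y := by
    rw [parity_gradedBracket, hy]
    simp
  have hmul : ∀ x x' : ExtAlg n,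
      (2 : ℂ) • gradedBracket A (gradedBracket A x y) y
        = gradedBracket A x (gradedBracket A y y) →
      (2 : ℂ) • gradedBracket A (gradedBracket A x' y) y
        = gradedBracket A x' (gradedBracket A y y) →
      (2 : ℂ) • gradedBracket A (gradedBracket A (x * x') y) y
        = gradedBracket A (x * x') (gradedBracket A y y) := by
    intro x x' hx hx'
    rw [gradedBracket_mul_of_even A hR, ← hx, ← hx', gradedBracket_mul_of_odd A hy, map_add,
      LinearMap.add_apply, gradedBracket_mul_of_odd A hy, gradedBracket_mul_of_odd A hy,
      parity_gradedBracket, hy, parity_parity]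
    have h : gradedBracket A (parity x') (-y) = -gradedBracket A (parity x') y := map_neg _ _
    rw [h, mul_neg, mul_smul_comm, smul_mul_assoc, ← smul_add]
    congr 1
    abel
  have hG : ∀ f : MvPolynomial (Fin n) ℂ,
      (2 : ℂ) • gradedBracket A (gradedBracket A (ofPoly f) y) y
        = gradedBracket A (ofPoly f) (gradedBracket A y y) := by
    intro f
    induction f using MvPolynomial.induction_on with
    | C c =>
      have h : ∀ z, gradedBracket A (ofPoly (MvPolynomial.C c)) z = 0 := fun z => by
        simp only [gradedBracket_ofPoly, MvPolynomial.pderiv_C]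
        simp [ofPoly]
      rw [h, h, map_zero, LinearMap.zero_apply, smul_zero]
    | add f g hf hg =>
      simp only [ofPoly_add, map_add, LinearMap.add_apply, smul_add, hf, hg]
    | mul_X f a hf =>
      rw [ofPoly_mul]
      exact hmul _ _ hf (gradedBracket_gradedBracket_genG A hy a)
  induction x using ExtAlg.induction with
  | h₀ f => exact hG f
  | h_add x x' hx hx' => simp only [map_add, LinearMap.add_apply, smul_add, hx, hx']
  | h_mul i x hx =>
    refine hmul _ _ ?_ hx
    rw [gradedBracket_ghostVar, gradedBracket_ghostVar, dLeft_gradedBracket_self A hy, map_neg,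
      LinearMap.neg_apply, smul_neg]

/-- For `x = y` the formula for the square reads `2 [[y, y], y] = [y, [y, y]] = -[[y, y], y]`. -/
theorem gradedBracket_gradedBracket_self {y : ExtAlg n} (hy : parity y = -y) :
    gradedBracket A (gradedBracket A y y) y = 0 := by
  have hR : parity (gradedBracket A y y) = gradedBracket A y y := by
    rw [parity_gradedBracket, hy]
    simp
  have h := two_smul_gradedBracket_gradedBracket A hy y
  rw [gradedBracket_skew_of_odd_of_even A hy hR, eq_neg_iff_add_eq_zero] at h
  have h₃ : (3 : ℂ) • gradedBracket A (gradedBracket A y y) y = 0 := by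
    rw [← h]
    module
  exact (smul_eq_zero.mp h₃).resolve_left (by norm_num)

/-! ### The bigrading by ghost momenta and ghosts -/

section MonomialSpan

variable {R : Type*} [Ring R] [Algebra ℂ R] {ι₀ ι₁ ι₂ : Type*} {c : ι₀ → R} {p : ι₁ → R}
  {q : ι₂ → R}

theorem mem_range_pow {M : Type*} [Monoid M] {ι : Type*} (f : ι → M) (k : ℕ) (x : M) :
    (∃ g : Fin k → Set.range f, (List.ofFn fun i => (g i : M)).prod = x) ↔
      ∃ p : Fin k → ι, x = (List.ofFn fun i => f (p i)).prod := by
  constructor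
  · rintro ⟨g, rfl⟩
    choose p hp using fun i => (g i).2
    exact ⟨p, by simp only [hp]⟩
  · rintro ⟨p, rfl⟩
    exact ⟨fun i => ⟨f (p i), p i, rfl⟩, rfl⟩

open scoped Pointwise in
/-- The span of the monomials `c * p ⋯ p * q ⋯ q` as a product of subspaces. -/
theorem span_monomials_eq (k l : ℕ) :
    Submodule.span ℂ {x | ∃ (a : ι₀) (i : Fin k → ι₁) (j : Fin l → ι₂),
      x = c a * (List.ofFn fun m => p (i m)).prod * (List.ofFn fun m => q (j m)).prod} =
    Submodule.span ℂ (Set.range c) * Submodule.span ℂ (Set.range p) ^ k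
      * Submodule.span ℂ (Set.range q) ^ l := by
  rw [Submodule.span_pow, Submodule.span_pow, Submodule.span_mul_span, Submodule.span_mul_span]
  congr 1
  ext x
  constructor
  · rintro ⟨f, i, j, rfl⟩
    exact Set.mul_mem_mul (Set.mul_mem_mul ⟨f, rfl⟩
      (Set.mem_pow.2 ((mem_range_pow _ _ _).2 ⟨i, rfl⟩)))
      (Set.mem_pow.2 ((mem_range_pow _ _ _).2 ⟨j, rfl⟩))
  · rintro ⟨_, ⟨_, ⟨f, rfl⟩, y, hy, rfl⟩, z, hz, rfl⟩
    obtain ⟨i, rfl⟩ := (mem_range_pow _ _ _).1 (Set.mem_pow.1 hy)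
    obtain ⟨j, rfl⟩ := (mem_range_pow _ _ _).1 (Set.mem_pow.1 hz)
    exact ⟨f, i, j, rfl⟩

/-- If the `c` are closed under products and central, and the `p` anticommute with the `q`, then
the spans of monomials multiply according to their degrees. -/
theorem mul_mem_span_monomials (hcc : ∀ a b, c a * c b ∈ Set.range c)
    (hc : ∀ a x, c a * x = x * c a) (hpq : ∀ i j, q j * p i = -(p i * q j)) {k l k' l' : ℕ}
    {x y : R}
    (hx : x ∈ Submodule.span ℂ {x | ∃ (a : ι₀) (i : Fin k → ι₁) (j : Fin l → ι₂),
      x = c a * (List.ofFn fun m => p (i m)).prod * (List.ofFn fun m => q (j m)).prod})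
    (hy : y ∈ Submodule.span ℂ {x | ∃ (a : ι₀) (i : Fin k' → ι₁) (j : Fin l' → ι₂),
      x = c a * (List.ofFn fun m => p (i m)).prod * (List.ofFn fun m => q (j m)).prod}) :
    x * y ∈ Submodule.span ℂ {x | ∃ (a : ι₀) (i : Fin (k + k') → ι₁) (j : Fin (l + l') → ι₂),
      x = c a * (List.ofFn fun m => p (i m)).prod * (List.ofFn fun m => q (j m)).prod} := by
  rw [span_monomials_eq] at hx hy ⊢
  set B := Submodule.span ℂ (Set.range c)
  set P := Submodule.span ℂ (Set.range p)
  set H := Submodule.span ℂ (Set.range q)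
  have hBB : B * B ≤ B := by
    rw [Submodule.span_mul_span, Submodule.span_le]
    rintro _ ⟨_, ⟨a, rfl⟩, _, ⟨b, rfl⟩, rfl⟩
    exact Submodule.subset_span (hcc a b)
  have hBx : ∀ x ∈ B, ∀ y, x * y = y * x := by
    intro x hx y
    induction hx using Submodule.span_induction with
    | mem x hx => obtain ⟨f, rfl⟩ := hx; exact hc f y
    | zero => simp
    | add x x' _ _ hx hx' => rw [add_mul, mul_add, hx, hx']
    | smul c x _ hx => rw [smul_mul_assoc, mul_smul_comm, hx]
  have hB : ∀ N : Submodule ℂ R, B * N = N * B := fun N => by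
    refine le_antisymm ?_ ?_
    · exact Submodule.mul_le.2 fun x hx y hy => hBx x hx y ▸ Submodule.mul_mem_mul hy hx
    · exact Submodule.mul_le.2 fun y hy x hx => hBx x hx y ▸ Submodule.mul_mem_mul hx hy
  have hHP : Commute H P := by
    rw [Commute, SemiconjBy, Submodule.span_mul_span, Submodule.span_mul_span]
    refine le_antisymm (Submodule.span_le.2 ?_) (Submodule.span_le.2 ?_)
    · rintro _ ⟨_, ⟨a, rfl⟩, _, ⟨b, rfl⟩, rfl⟩
      simp only [hpq]
      exact Submodule.neg_mem _ (Submodule.subset_span ⟨_, ⟨b, rfl⟩, _, ⟨a, rfl⟩, rfl⟩)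
    · rintro _ ⟨_, ⟨b, rfl⟩, _, ⟨a, rfl⟩, rfl⟩
      have h := neg_eq_iff_eq_neg.2 (hpq b a)
      simp only [← h]
      exact Submodule.neg_mem _ (Submodule.subset_span ⟨_, ⟨a, rfl⟩, _, ⟨b, rfl⟩, rfl⟩)
  have h : B * P ^ k * H ^ l * (B * P ^ k' * H ^ l') ≤ B * P ^ (k + k') * H ^ (l + l') := by
    calc B * P ^ k * H ^ l * (B * P ^ k' * H ^ l')
        = B * (P ^ k * (H ^ l * B)) * P ^ k' * H ^ l' := by simp only [mul_assoc]
      _ = B * B * P ^ k * (H ^ l * P ^ k') * H ^ l' := by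
          rw [← hB (H ^ l), ← mul_assoc (P ^ k), ← hB (P ^ k)]; simp only [mul_assoc]
      _ = B * B * (P ^ (k + k') * H ^ (l + l')) := by
          rw [(hHP.pow_pow l k').eq, pow_add, pow_add]; simp only [mul_assoc]
      _ ≤ B * (P ^ (k + k') * H ^ (l + l')) := mul_le_mul_left hBB _
      _ = _ := (mul_assoc _ _ _).symm
  exact h (Submodule.mul_mem_mul hx hy)

end MonomialSpan

theorem ghost_mul_ghostMom (a b : Fin n) :
    ghost a * ghostMom b = -(ghostMom b * ghost a) := by
  rw [ghost, ghostVar_mul, ghostMom, parity_ghostVar, neg_mul]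

theorem mul_mem_bidegree {k l k' l' : ℕ} {x y : ExtAlg n} (hx : x ∈ bidegree (n := n) k l)
    (hy : y ∈ bidegree (n := n) k' l') : x * y ∈ bidegree (n := n) (k + k') (l + l') :=
  mul_mem_span_monomials (fun f g => ⟨f * g, ofPoly_mul f g⟩) ofPoly_comm
    (fun i j => ghost_mul_ghostMom j i) hx hy

theorem ofPoly_mem_bidegree (f : MvPolynomial (Fin n) ℂ) : ofPoly f ∈ bidegree (n := n) 0 0 :=
  Submodule.subset_span ⟨f, Fin.elim0, Fin.elim0, by simp⟩

theorem ghostMom_mem_bidegree (a : Fin n) : ghostMom a ∈ bidegree (n := n) 1 0 :=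
  Submodule.subset_span ⟨1, fun _ => a, Fin.elim0, by simp [ofPoly_one]⟩

theorem ghost_mem_bidegree (a : Fin n) : ghost a ∈ bidegree (n := n) 0 1 :=
  Submodule.subset_span ⟨1, Fin.elim0, fun _ => a, by simp [ofPoly_one]⟩

theorem ofPoly_mul_mem_bidegree {k l : ℕ} (f : MvPolynomial (Fin n) ℂ) {x : ExtAlg n}
    (hx : x ∈ bidegree (n := n) k l) : ofPoly f * x ∈ bidegree (n := n) k l := by
  simpa using mul_mem_bidegree (ofPoly_mem_bidegree f) hx

theorem ghostMom_mul_mem_bidegree {k l : ℕ} (a : Fin n) {x : ExtAlg n}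
    (hx : x ∈ bidegree (n := n) k l) : ghostMom a * x ∈ bidegree (n := n) (k + 1) l := by
  simpa [add_comm] using mul_mem_bidegree (ghostMom_mem_bidegree a) hx

theorem ghost_mul_mem_bidegree {k l : ℕ} (a : Fin n) {x : ExtAlg n}
    (hx : x ∈ bidegree (n := n) k l) : ghost a * x ∈ bidegree (n := n) k (l + 1) := by
  simpa [add_comm] using mul_mem_bidegree (ghost_mem_bidegree a) hx

/-- Induction on the monomials of the extended algebra, one variable at a time. -/
theorem bidegree_induction {P : ∀ (k l : ℕ) (x : ExtAlg n), x ∈ bidegree (n := n) k l → Prop}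
    (h₀ : ∀ f, P 0 0 (ofPoly f) (ofPoly_mem_bidegree f))
    (h_add : ∀ k l x y hx hy, P k l x hx → P k l y hy → P k l (x + y) (Submodule.add_mem _ hx hy))
    (h_mom : ∀ k l x a hx, P k l x hx →
      P (k + 1) l (ghostMom a * x) (ghostMom_mul_mem_bidegree a hx))
    (h_ghost : ∀ l x a hx, P 0 l x hx → P 0 (l + 1) (ghost a * x) (ghost_mul_mem_bidegree a hx))
    (h_zero : ∀ k l, P k l 0 (Submodule.zero_mem _))
    {k l : ℕ} {x : ExtAlg n} (hx : x ∈ bidegree (n := n) k l) : P k l x hx := by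
  suffices h : ∃ hx : x ∈ bidegree (n := n) k l, P k l x hx from h.2
  have hmon : ∀ (f : MvPolynomial (Fin n) ℂ) (p : Fin k → Fin n) (q : Fin l → Fin n),
      ∃ h, P k l (ofPoly f * (List.ofFn fun i => ghostMom (p i)).prod
        * (List.ofFn fun j => ghost (q j)).prod) h := by
    intro f
    clear hx
    induction k with
    | zero =>
      induction l with
      | zero =>
        intro p q
        simpa using (⟨_, h₀ f⟩ : ∃ h, P 0 0 _ h)
      | succ l ih =>
        intro p q
        obtain ⟨h', ih⟩ := ih p fun j => q j.succ
        have h := (⟨_, h_ghost l _ (q 0) h' ih⟩ : ∃ h, P 0 (l + 1) _ h)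
        refine (congrArg (fun x => ∃ h, P 0 (l + 1) x h) ?_).mp h
        rw [List.ofFn_succ (f := fun j => ghost (q j)), List.prod_cons]
        simp only [List.ofFn_zero, List.prod_nil, mul_one]
        rw [← mul_assoc, ← ofPoly_comm, mul_assoc]
    | succ k ih =>
      intro p q
      obtain ⟨h', ih⟩ := ih (fun j => p j.succ) q
      have h := (⟨_, h_mom k l _ (p 0) h' ih⟩ : ∃ h, P (k + 1) l _ h)
      refine (congrArg (fun x => ∃ h, P (k + 1) l x h) ?_).mp h
      rw [List.ofFn_succ (f := fun j => ghostMom (p j)), List.prod_cons]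
      simp only [mul_assoc]
      rw [← mul_assoc (ghostMom _) (ofPoly f), ← ofPoly_comm f (ghostMom _), mul_assoc]
  rw [bidegree, Submodule.mem_span_set'] at hx
  obtain ⟨m, c, g, rfl⟩ := hx
  refine Finset.sum_induction _ (fun x => ∃ h, P k l x h)
    (fun x y hx hy => ⟨_, h_add k l x y hx.1 hy.1 hx.2 hy.2⟩) ⟨_, h_zero k l⟩ fun i _ => ?_
  obtain ⟨f, p, q, h⟩ := (g i).2
  have h' := hmon (c i • f) p q
  rw [h]
  rwa [show ofPoly (c i • f) = c i • ofPoly f from rfl, smul_mul_assoc, smul_mul_assoc] at h'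

theorem parity_bidegree {k l : ℕ} {x : ExtAlg n} (hx : x ∈ bidegree (n := n) k l) :
    parity x = (-1 : ℂ) ^ (k + l) • x := by
  induction hx using bidegree_induction with
  | h₀ f => simp
  | h_add k l x y _ _ hx hy => rw [map_add, hx, hy, smul_add]
  | h_mom k l x a _ hx =>
    rw [map_mul, hx, ghostMom, parity_ghostVar, neg_mul, mul_smul_comm, ← neg_smul]
    congr 1
    ring
  | h_ghost l x a _ hx =>
    rw [map_mul, hx, ghost, parity_ghostVar, neg_mul, mul_smul_comm, ← neg_smul]
    congr 1
    ring
  | h_zero k l => simp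

theorem parity_mem_bidegree {k l : ℕ} {x : ExtAlg n} (hx : x ∈ bidegree (n := n) k l) :
    parity x ∈ bidegree (n := n) k l := by
  rw [parity_bidegree hx]
  exact Submodule.smul_mem _ _ hx

theorem dG_mem_bidegree (c : Fin n) {k l : ℕ} {x : ExtAlg n} (hx : x ∈ bidegree (n := n) k l) :
    dG c x ∈ bidegree (n := n) k l := by
  induction hx using bidegree_induction with
  | h₀ f => exact ofPoly_mem_bidegree _
  | h_add k l x y _ _ hx hy => rw [map_add]; exact Submodule.add_mem _ hx hy
  | h_mom k l x a _ hx =>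
    rw [dG_mul, ghostMom, dG_ghostVar, zero_mul, zero_add]
    exact ghostMom_mul_mem_bidegree a hx
  | h_ghost l x a _ hx =>
    rw [dG_mul, ghost, dG_ghostVar, zero_mul, zero_add]
    exact ghost_mul_mem_bidegree a hx
  | h_zero k l => simp

theorem dLeft_ghostMom_mul (i : Fin n ⊕ Fin n) (a : Fin n) (x : ExtAlg n) :
    dLeft i (ghostMom a * x) = (if i = Sum.inl a then x else 0) - ghostMom a * dLeft i x := by
  rw [dLeft_mul, ghostMom, dLeft_ghostVar, parity_ghostVar, neg_mul, ← sub_eq_add_neg, ite_mul,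
    one_mul, zero_mul]

theorem dLeft_ghost_mul (i : Fin n ⊕ Fin n) (a : Fin n) (x : ExtAlg n) :
    dLeft i (ghost a * x) = (if i = Sum.inr a then x else 0) - ghost a * dLeft i x := by
  rw [dLeft_mul, ghost, dLeft_ghostVar, parity_ghostVar, neg_mul, ← sub_eq_add_neg, ite_mul,
    one_mul, zero_mul]

/-- The left derivative by a ghost momentum lowers the number of ghost momenta by one. -/
theorem dLeft_inl_mem_bidegree (c : Fin n) {k l : ℕ} {x : ExtAlg n}
    (hx : x ∈ bidegree (n := n) k l) :
    (k = 0 → dLeft (Sum.inl c) x = 0) ∧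
      ∀ m, k = m + 1 → dLeft (Sum.inl c) x ∈ bidegree (n := n) m l := by
  induction hx using bidegree_induction with
  | h₀ f => simp
  | h_add k l x y _ _ hx hy =>
    refine ⟨fun h => by rw [map_add, hx.1 h, hy.1 h, add_zero], fun m hm => ?_⟩
    rw [map_add]
    exact Submodule.add_mem _ (hx.2 m hm) (hy.2 m hm)
  | h_mom k l x a hmem hx =>
    refine ⟨by simp, fun m hm => ?_⟩
    obtain rfl : k = m := by simpa using hm
    rw [dLeft_ghostMom_mul]
    refine Submodule.sub_mem _ (by split_ifs <;> simp [hmem]) ?_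
    cases k with
    | zero => simp [hx.1 rfl]
    | succ k => exact ghostMom_mul_mem_bidegree a (hx.2 k rfl)
  | h_ghost l x a hmem hx =>
    refine ⟨fun _ => ?_, by simp⟩
    rw [dLeft_ghost_mul, hx.1 rfl]
    simp
  | h_zero k l => simp

/-- The left derivative by a ghost lowers the number of ghosts by one. -/
theorem dLeft_inr_mem_bidegree (c : Fin n) {k l : ℕ} {x : ExtAlg n}
    (hx : x ∈ bidegree (n := n) k l) :
    (l = 0 → dLeft (Sum.inr c) x = 0) ∧
      ∀ m, l = m + 1 → dLeft (Sum.inr c) x ∈ bidegree (n := n) k m := by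
  induction hx using bidegree_induction with
  | h₀ f => simp
  | h_add k l x y _ _ hx hy =>
    refine ⟨fun h => by rw [map_add, hx.1 h, hy.1 h, add_zero], fun m hm => ?_⟩
    rw [map_add]
    exact Submodule.add_mem _ (hx.2 m hm) (hy.2 m hm)
  | h_mom k l x a hmem hx =>
    refine ⟨fun h => by rw [dLeft_ghostMom_mul, hx.1 h]; simp, fun m hm => ?_⟩
    rw [dLeft_ghostMom_mul, if_neg (by simp), zero_sub]
    exact Submodule.neg_mem _ (ghostMom_mul_mem_bidegree a (hx.2 m hm))
  | h_ghost l x a hmem hx =>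
    refine ⟨by simp, fun m hm => ?_⟩
    obtain rfl : l = m := by simpa using hm
    rw [dLeft_ghost_mul]
    refine Submodule.sub_mem _ (by split_ifs <;> simp [hmem]) ?_
    cases l with
    | zero => simp [hx.1 rfl]
    | succ l => exact ghost_mul_mem_bidegree a (hx.2 l rfl)
  | h_zero k l => simp

theorem bidegree_eq_bot {k : ℕ} (l : ℕ) (hk : n < k) : bidegree (n := n) k l = ⊥ := by
  rw [bidegree, Submodule.span_eq_bot]
  rintro _ ⟨f, p, q, rfl⟩
  have hp : ¬ Function.Injective p := fun h => by
    have := Fintype.card_le_of_injective p h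
    simp at this
    omega
  have h : (List.ofFn fun i => ghostMom (p i)).prod = (0 : ExtAlg n) := by
    have h₁ : (List.ofFn fun i => ghostMom (p i)).prod
        = (Algebra.TensorProduct.includeRight : GhostAlg n →ₐ[ℂ] ExtAlg n)
          (ExteriorAlgebra.ιMulti ℂ k fun i => Pi.single (Sum.inl (p i)) 1) := by
      rw [ExteriorAlgebra.ιMulti_apply, map_list_prod, List.map_ofFn]
      rfl
    rw [h₁, ExteriorAlgebra.ιMulti_eq_zero_of_not_inj, map_zero]
    intro h
    refine hp fun i j hij => h ?_
    simp only [hij]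
  rw [h, mul_zero, zero_mul]

/-! ### The antighost filtration and the ghost number -/

/-- The span of the monomials containing at least `k` ghost momenta. -/
noncomputable def antighostGE (k : ℕ) : Submodule ℂ (ExtAlg n) :=
  ⨆ (k' : ℕ) (l : ℕ) (_ : k ≤ k'), bidegree k' l

theorem antighostGE_one : antighostGE (n := n) 1 = positiveAntighost := rfl

theorem bidegree_le_antighostGE {k k' : ℕ} (l : ℕ) (h : k ≤ k') :
    bidegree (n := n) k' l ≤ antighostGE k :=
  le_iSup_of_le k' (le_iSup_of_le l (le_iSup_of_le h le_rfl))

theorem antighostGE_le {k : ℕ} {N : Submodule ℂ (ExtAlg n)}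
    (h : ∀ k' l, k ≤ k' → bidegree (n := n) k' l ≤ N) : antighostGE k ≤ N :=
  iSup_le fun k' => iSup_le fun l => iSup_le fun hk => h k' l hk

theorem antighostGE_anti {k k' : ℕ} (h : k ≤ k') :
    antighostGE (n := n) k' ≤ antighostGE k :=
  antighostGE_le fun _ l hk => bidegree_le_antighostGE l (h.trans hk)

theorem bidegree_le_ghostNumber {k l : ℕ} {g : ℤ} (h : (l : ℤ) - k = g) :
    bidegree (n := n) k l ≤ ghostNumber g :=
  le_iSup_of_le k (le_iSup_of_le l (le_iSup_of_le h le_rfl))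

theorem ghostNumber_le {g : ℤ} {N : Submodule ℂ (ExtAlg n)}
    (h : ∀ k l : ℕ, (l : ℤ) - k = g → bidegree (n := n) k l ≤ N) : ghostNumber g ≤ N :=
  iSup_le fun k => iSup_le fun l => iSup_le fun hk => h k l hk

theorem antighostGE_eq_bot : antighostGE (n := n) (n + 1) = ⊥ := by
  rw [eq_bot_iff]
  exact antighostGE_le fun k l hk => (bidegree_eq_bot l hk).le

theorem antighostGE_map (f : ExtAlg n →ₗ[ℂ] ExtAlg n) {k m : ℕ}
    (h : ∀ k' l, k ≤ k' → ∀ x ∈ bidegree (n := n) k' l, f x ∈ antighostGE (n := n) m)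
    {x : ExtAlg n} (hx : x ∈ antighostGE (n := n) k) : f x ∈ antighostGE (n := n) m :=
  antighostGE_le (N := (antighostGE m).comap f) (fun k' l hk x hx => h k' l hk x hx) hx

theorem ghostNumber_map (f : ExtAlg n →ₗ[ℂ] ExtAlg n) {g g' : ℤ}
    (h : ∀ k l : ℕ, (l : ℤ) - k = g → ∀ x ∈ bidegree (n := n) k l, f x ∈ ghostNumber (n := n) g')
    {x : ExtAlg n} (hx : x ∈ ghostNumber (n := n) g) : f x ∈ ghostNumber (n := n) g' :=
  ghostNumber_le (N := (ghostNumber g').comap f) (fun k l hk x hx => h k l hk x hx) hx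

theorem mul_mem_antighostGE {k m : ℕ} {x y : ExtAlg n} (hx : x ∈ antighostGE (n := n) k)
    (hy : y ∈ antighostGE (n := n) m) : x * y ∈ antighostGE (n := n) (k + m) := by
  refine antighostGE_map (LinearMap.mulRight ℂ y) (fun k' l hk x hx => ?_) hx
  refine antighostGE_map (LinearMap.mulLeft ℂ x) (fun m' l' hm y hy => ?_) hy
  exact bidegree_le_antighostGE _ (add_le_add hk hm) (mul_mem_bidegree hx hy)

theorem mul_mem_ghostNumber {g g' : ℤ} {x y : ExtAlg n} (hx : x ∈ ghostNumber (n := n) g)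
    (hy : y ∈ ghostNumber (n := n) g') : x * y ∈ ghostNumber (n := n) (g + g') := by
  refine ghostNumber_map (LinearMap.mulRight ℂ y) (fun k l hk x hx => ?_) hx
  refine ghostNumber_map (LinearMap.mulLeft ℂ x) (fun k' l' hk' y hy => ?_) hy
  refine bidegree_le_ghostNumber ?_ (mul_mem_bidegree hx hy)
  push_cast
  omega

theorem mem_antighostGE_zero (x : ExtAlg n) : x ∈ antighostGE (n := n) 0 := by
  induction x using ExtAlg.induction with
  | h₀ f => exact bidegree_le_antighostGE _ le_rfl (ofPoly_mem_bidegree f)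
  | h_add x y hx hy => exact Submodule.add_mem _ hx hy
  | h_mul i x hx =>
    refine mul_mem_antighostGE (k := 0) (m := 0) ?_ hx
    cases i with
    | inl a => exact bidegree_le_antighostGE _ (Nat.zero_le _) (ghostMom_mem_bidegree a)
    | inr a => exact bidegree_le_antighostGE _ (Nat.zero_le _) (ghost_mem_bidegree a)

theorem mul_mem_antighostGE_left {k : ℕ} {x : ExtAlg n} (hx : x ∈ antighostGE (n := n) k)
    (y : ExtAlg n) : x * y ∈ antighostGE (n := n) k := by
  have h := mul_mem_antighostGE hx (mem_antighostGE_zero y)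
  rwa [add_zero] at h

theorem mul_mem_antighostGE_right {k : ℕ} (x : ExtAlg n) {y : ExtAlg n}
    (hy : y ∈ antighostGE (n := n) k) : x * y ∈ antighostGE (n := n) k := by
  simpa using mul_mem_antighostGE (mem_antighostGE_zero x) hy

theorem ofPoly_mem_ghostNumber (f : MvPolynomial (Fin n) ℂ) :
    ofPoly f ∈ ghostNumber (n := n) 0 :=
  bidegree_le_ghostNumber (by simp) (ofPoly_mem_bidegree f)

theorem ghostMom_mem_ghostNumber (a : Fin n) : ghostMom a ∈ ghostNumber (n := n) (-1) :=
  bidegree_le_ghostNumber (by simp) (ghostMom_mem_bidegree a)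

theorem ghost_mem_ghostNumber (a : Fin n) : ghost a ∈ ghostNumber (n := n) 1 :=
  bidegree_le_ghostNumber (by simp) (ghost_mem_bidegree a)

theorem ghostMom_mem_antighostGE (a : Fin n) : ghostMom a ∈ antighostGE (n := n) 1 :=
  bidegree_le_antighostGE _ le_rfl (ghostMom_mem_bidegree a)

section Operators

variable {k : ℕ} {g : ℤ} {x : ExtAlg n}

theorem dG_mem_antighostGE (a : Fin n) (hx : x ∈ antighostGE (n := n) k) :
    dG a x ∈ antighostGE (n := n) k :=
  antighostGE_map _ (fun _ l hk _ hx => bidegree_le_antighostGE l hk (dG_mem_bidegree a hx)) hx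

theorem dG_mem_ghostNumber (a : Fin n) (hx : x ∈ ghostNumber (n := n) g) :
    dG a x ∈ ghostNumber (n := n) g :=
  ghostNumber_map _ (fun _ _ hk _ hx => bidegree_le_ghostNumber hk (dG_mem_bidegree a hx)) hx

theorem parity_mem_antighostGE (hx : x ∈ antighostGE (n := n) k) :
    parity x ∈ antighostGE (n := n) k :=
  antighostGE_map parity.toLinearMap
    (fun _ l hk _ hx => bidegree_le_antighostGE l hk (parity_mem_bidegree hx)) hx

theorem parity_mem_ghostNumber (hx : x ∈ ghostNumber (n := n) g) :
    parity x ∈ ghostNumber (n := n) g :=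
  ghostNumber_map parity.toLinearMap
    (fun _ _ hk _ hx => bidegree_le_ghostNumber hk (parity_mem_bidegree hx)) hx

theorem dLeft_inl_mem_antighostGE (a : Fin n) (hx : x ∈ antighostGE (n := n) (k + 1)) :
    dLeft (Sum.inl a) x ∈ antighostGE (n := n) k := by
  refine antighostGE_map _ (fun k' l hk x hx => ?_) hx
  obtain ⟨m, rfl⟩ : ∃ m, k' = m + 1 := ⟨k' - 1, by omega⟩
  exact bidegree_le_antighostGE l (by omega) ((dLeft_inl_mem_bidegree a hx).2 m rfl)

theorem dLeft_inl_mem_ghostNumber (a : Fin n) (hx : x ∈ ghostNumber (n := n) g) :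
    dLeft (Sum.inl a) x ∈ ghostNumber (n := n) (g + 1) := by
  refine ghostNumber_map _ (fun k l hk x hx => ?_) hx
  cases k with
  | zero => rw [(dLeft_inl_mem_bidegree a hx).1 rfl]; exact Submodule.zero_mem _
  | succ m =>
    exact bidegree_le_ghostNumber (by push_cast at hk; omega)
      ((dLeft_inl_mem_bidegree a hx).2 m rfl)

theorem dLeft_inr_mem_antighostGE (a : Fin n) (hx : x ∈ antighostGE (n := n) k) :
    dLeft (Sum.inr a) x ∈ antighostGE (n := n) k := by
  refine antighostGE_map _ (fun k l hk x hx => ?_) hx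
  cases l with
  | zero => rw [(dLeft_inr_mem_bidegree a hx).1 rfl]; exact Submodule.zero_mem _
  | succ m => exact bidegree_le_antighostGE m hk ((dLeft_inr_mem_bidegree a hx).2 m rfl)

theorem dLeft_inr_mem_ghostNumber (a : Fin n) (hx : x ∈ ghostNumber (n := n) g) :
    dLeft (Sum.inr a) x ∈ ghostNumber (n := n) (g - 1) := by
  refine ghostNumber_map _ (fun k l hk x hx => ?_) hx
  cases l with
  | zero => rw [(dLeft_inr_mem_bidegree a hx).1 rfl]; exact Submodule.zero_mem _
  | succ m =>
    exact bidegree_le_ghostNumber (by push_cast at hk; omega)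
      ((dLeft_inr_mem_bidegree a hx).2 m rfl)

theorem parity_of_mem_ghostNumber_one (hx : x ∈ ghostNumber (n := n) 1) : parity x = -x := by
  have h : ghostNumber (n := n) 1 ≤ LinearMap.ker (parity.toLinearMap + LinearMap.id) :=
    ghostNumber_le fun k l hkl x hx => by
      obtain rfl : l = k + 1 := by omega
      have hp : Odd (k + (k + 1)) := ⟨k, by ring⟩
      rw [LinearMap.mem_ker, LinearMap.add_apply, AlgHom.toLinearMap_apply, parity_bidegree hx,
        hp.neg_one_pow, neg_one_smul, LinearMap.id_apply, neg_add_cancel]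
  exact eq_neg_of_add_eq_zero_left (h hx)

end Operators

theorem gradedBracket_mem_ghostNumber {g g' : ℤ} {x y : ExtAlg n}
    (hx : x ∈ ghostNumber (n := n) g) (hy : y ∈ ghostNumber (n := n) g') :
    gradedBracket A x y ∈ ghostNumber (n := n) (g + g') := by
  rw [gradedBracket_apply, Fintype.sum_sum_type]
  refine Submodule.sub_mem _ (Submodule.sum_mem _ fun a _ => ?_) (Submodule.add_mem _
    (Submodule.sum_mem _ fun a _ => ?_) (Submodule.sum_mem _ fun a _ => ?_))
  · refine mul_mem_ghostNumber (dG_mem_ghostNumber a hx) (Submodule.sum_mem _ fun b _ => ?_)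
    simpa using mul_mem_ghostNumber (ofPoly_mem_ghostNumber (A.C a b)) (dG_mem_ghostNumber b hy)
  · have h := mul_mem_ghostNumber (parity_mem_ghostNumber (dLeft_inl_mem_ghostNumber a hx))
      (dLeft_inr_mem_ghostNumber a hy)
    rwa [show g + 1 + (g' - 1) = g + g' by ring] at h
  · have h := mul_mem_ghostNumber (parity_mem_ghostNumber (dLeft_inr_mem_ghostNumber a hx))
      (dLeft_inl_mem_ghostNumber a hy)
    rwa [show g - 1 + (g' + 1) = g + g' by ring] at h

theorem gradedBracket_self_mem_antighostGE {k : ℕ} {y : ExtAlg n}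
    (hy : y ∈ antighostGE (n := n) (k + 1)) :
    gradedBracket A y y ∈ antighostGE (n := n) (k + 1) := by
  rw [gradedBracket_apply, Fintype.sum_sum_type]
  refine Submodule.sub_mem _ (Submodule.sum_mem _ fun a _ => ?_) (Submodule.add_mem _
    (Submodule.sum_mem _ fun a _ => ?_) (Submodule.sum_mem _ fun a _ => ?_))
  · exact mul_mem_antighostGE_left (dG_mem_antighostGE a hy) _
  · exact mul_mem_antighostGE_right _ (dLeft_inr_mem_antighostGE a hy)
  · exact mul_mem_antighostGE_left (parity_mem_antighostGE (dLeft_inr_mem_antighostGE a hy)) _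

/-! ### The Koszul differential -/

/-- The Koszul differential `δ = G_a ∂/∂𝒫_a`. -/
noncomputable def koszul : ExtAlg n →ₗ[ℂ] ExtAlg n :=
  ∑ a, LinearMap.mulLeft ℂ (genG a) ∘ₗ dLeft (Sum.inl a)

/-- The contracting homotopy `𝒫_a ∂/∂G_a` of the Koszul differential. -/
noncomputable def koszulHomotopy : ExtAlg n →ₗ[ℂ] ExtAlg n :=
  ∑ a, LinearMap.mulLeft ℂ (ghostMom a) ∘ₗ dG a

/-- The operator counting the `G_a` and the `𝒫_a` in a monomial. -/
noncomputable def euler : ExtAlg n →ₗ[ℂ] ExtAlg n :=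
  ∑ a, (LinearMap.mulLeft ℂ (genG a) ∘ₗ dG a
    + LinearMap.mulLeft ℂ (ghostMom a) ∘ₗ dLeft (Sum.inl a))

theorem koszul_apply (x : ExtAlg n) : koszul x = ∑ a, genG a * dLeft (Sum.inl a) x := by
  simp [koszul]

theorem koszulHomotopy_apply (x : ExtAlg n) :
    koszulHomotopy x = ∑ a, ghostMom a * dG a x := by
  simp [koszulHomotopy]

theorem euler_apply (x : ExtAlg n) :
    euler x = ∑ a, (genG a * dG a x + ghostMom a * dLeft (Sum.inl a) x) := by
  simp [euler]

theorem dG_genG_mul (a b : Fin n) (x : ExtAlg n) :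
    dG a (genG b * x) = (if a = b then x else 0) + genG b * dG a x := by
  rw [dG_mul, genG, dG_ofPoly]
  split_ifs with h
  · rw [h, MvPolynomial.pderiv_X_self, ofPoly_one, one_mul]
  · rw [MvPolynomial.pderiv_X_of_ne (Ne.symm h), ofPoly, TensorProduct.zero_tmul, zero_mul]

theorem dLeft_ofPoly_mul (i : Fin n ⊕ Fin n) (f : MvPolynomial (Fin n) ℂ) (x : ExtAlg n) :
    dLeft i (ofPoly f * x) = ofPoly f * dLeft i x := by
  rw [dLeft_mul, dLeft_ofPoly, zero_mul, zero_add, parity_ofPoly]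

theorem dG_ghostVar_mul (a : Fin n) (i : Fin n ⊕ Fin n) (x : ExtAlg n) :
    dG a (ghostVar i * x) = ghostVar i * dG a x := by
  rw [dG_mul, dG_ghostVar, zero_mul, zero_add]

theorem koszul_koszulHomotopy_add (x : ExtAlg n) :
    koszul (koszulHomotopy x) + koszulHomotopy (koszul x) = euler x := by
  have h₁ : koszul (koszulHomotopy x) = ∑ a, genG a * dG a x
      - ∑ a, ∑ b, genG a * (ghostMom b * dLeft (Sum.inl a) (dG b x)) := by
    simp only [koszul_apply, koszulHomotopy_apply, map_sum, dLeft_ghostMom_mul, Sum.inl.injEq,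
      Finset.sum_sub_distrib, mul_sub, mul_ite, mul_zero,
      Finset.sum_ite_eq', Finset.mem_univ, if_true]
    exact congrArg _ Finset.sum_comm
  have h₂ : koszulHomotopy (koszul x) = ∑ a, ghostMom a * dLeft (Sum.inl a) x
      + ∑ a, ∑ b, ghostMom b * (genG a * dG b (dLeft (Sum.inl a) x)) := by
    simp only [koszul_apply, koszulHomotopy_apply, map_sum, dG_genG_mul,
      Finset.sum_add_distrib, mul_add, mul_ite, mul_zero,
      Finset.sum_ite_eq', Finset.mem_univ, if_true]
  have h₃ : ∀ a b, ghostMom b * (genG a * dG b (dLeft (Sum.inl a) x))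
      = genG a * (ghostMom b * dLeft (Sum.inl a) (dG b x)) := fun a b => by
    rw [← mul_assoc, genG, ← ofPoly_comm, mul_assoc, dLeft_dG]
  rw [h₁, h₂, euler_apply, Finset.sum_add_distrib]
  simp only [h₃]
  abel

theorem koszul_koszul (x : ExtAlg n) : koszul (koszul x) = 0 := by
  have h : koszul (koszul x) = -koszul (koszul x) := by
    conv_lhs => simp only [koszul_apply, map_sum, genG, dLeft_ofPoly_mul, Finset.mul_sum]
    conv_rhs => simp only [koszul_apply, map_sum, genG, dLeft_ofPoly_mul, Finset.mul_sum]
    conv_lhs => rw [Finset.sum_comm]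
    rw [← Finset.sum_neg_distrib]
    refine Finset.sum_congr rfl fun a _ => ?_
    rw [← Finset.sum_neg_distrib]
    refine Finset.sum_congr rfl fun b _ => ?_
    rw [dLeft_comm, ← mul_assoc, ← ofPoly_mul, mul_comm, ofPoly_mul]
    simp only [mul_neg, mul_assoc]
  rw [eq_neg_iff_add_eq_zero, ← two_smul ℂ] at h
  exact (smul_eq_zero.mp h).resolve_left two_ne_zero

theorem euler_koszul (x : ExtAlg n) : euler (koszul x) = koszul (euler x) := by
  rw [← koszul_koszulHomotopy_add, ← koszul_koszulHomotopy_add, koszul_koszul, map_zero, add_zero,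
    map_add, koszul_koszul, zero_add]

theorem koszul_parity (x : ExtAlg n) : koszul (parity x) = -parity (koszul x) := by
  simp only [koszul_apply, dLeft_parity, map_sum, map_mul, genG, parity_ofPoly, mul_neg,
    Finset.sum_neg_distrib]

theorem euler_genG_mul (b : Fin n) (x : ExtAlg n) :
    euler (genG b * x) = genG b * x + genG b * euler x := by
  have h : ∀ a, genG a * dG a (genG b * x) + ghostMom a * dLeft (Sum.inl a) (genG b * x)
      = (if a = b then genG a * x else 0)
        + genG b * (genG a * dG a x + ghostMom a * dLeft (Sum.inl a) x) := fun a => by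
    have h₁ : genG a * (genG b * dG a x) = genG b * (genG a * dG a x) := by
      rw [← mul_assoc, genG, ofPoly_comm, mul_assoc]
    have h₂ : ghostMom a * (genG b * dLeft (Sum.inl a) x)
        = genG b * (ghostMom a * dLeft (Sum.inl a) x) := by
      rw [← mul_assoc, genG, ← ofPoly_comm, mul_assoc]
    have h₃ : dLeft (Sum.inl a) (genG b * x) = genG b * dLeft (Sum.inl a) x :=
      dLeft_ofPoly_mul _ _ _
    rw [dG_genG_mul, mul_add, h₁, mul_add, mul_ite, mul_zero, add_assoc, h₃, h₂]
  rw [euler_apply, euler_apply, Finset.sum_congr rfl fun a _ => h a, Finset.sum_add_distrib,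
    Finset.mul_sum]
  simp

theorem euler_ghostMom_mul (b : Fin n) (x : ExtAlg n) :
    euler (ghostMom b * x) = ghostMom b * x + ghostMom b * euler x := by
  have h : ∀ a, genG a * dG a (ghostMom b * x) + ghostMom a * dLeft (Sum.inl a) (ghostMom b * x)
      = (if a = b then ghostMom a * x else 0)
        + ghostMom b * (genG a * dG a x + ghostMom a * dLeft (Sum.inl a) x) := fun a => by
    have h₁ : genG a * (ghostMom b * dG a x) = ghostMom b * (genG a * dG a x) := by
      rw [← mul_assoc, genG, ofPoly_comm, mul_assoc]
    have h₂ : ghostMom a * (ghostMom b * dLeft (Sum.inl a) x)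
        = -(ghostMom b * (ghostMom a * dLeft (Sum.inl a) x)) := by
      rw [← mul_assoc, ghostMom, ghostVar_mul, ghostMom, parity_ghostVar, neg_mul, neg_mul,
        mul_assoc]
    rw [dLeft_ghostMom_mul, mul_sub, h₂, ghostMom, dG_ghostVar_mul, ← ghostMom, h₁, mul_add,
      mul_ite, mul_zero]
    simp only [Sum.inl.injEq]
    abel
  rw [euler_apply, euler_apply, Finset.sum_congr rfl fun a _ => h a, Finset.sum_add_distrib,
    Finset.mul_sum]
  simp

theorem euler_ghost_mul (b : Fin n) (x : ExtAlg n) : euler (ghost b * x) = ghost b * euler x := by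
  rw [euler_apply, euler_apply, Finset.mul_sum]
  refine Finset.sum_congr rfl fun a _ => ?_
  have h₁ : genG a * (ghost b * dG a x) = ghost b * (genG a * dG a x) := by
    rw [← mul_assoc, genG, ofPoly_comm, mul_assoc]
  have h₂ : ghostMom a * (ghost b * dLeft (Sum.inl a) x)
      = -(ghost b * (ghostMom a * dLeft (Sum.inl a) x)) := by
    rw [← mul_assoc, ← mul_assoc, ghost_mul_ghostMom, neg_mul, neg_neg]
  rw [dLeft_ghost_mul, if_neg (by simp), zero_sub, mul_neg, h₂, neg_neg, ghost, dG_ghostVar_mul,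
    ← ghost, h₁, mul_add]

theorem euler_mem_bidegree {k l : ℕ} {x : ExtAlg n} (hx : x ∈ bidegree (n := n) k l) :
    euler x ∈ bidegree (n := n) k l := by
  rw [euler_apply]
  refine Submodule.sum_mem _ fun a _ => Submodule.add_mem _
    (ofPoly_mul_mem_bidegree _ (dG_mem_bidegree a hx)) ?_
  cases k with
  | zero => rw [(dLeft_inl_mem_bidegree a hx).1 rfl, mul_zero]; exact Submodule.zero_mem _
  | succ k => exact ghostMom_mul_mem_bidegree a ((dLeft_inl_mem_bidegree a hx).2 k rfl)

theorem euler_mem_antighostGE {k : ℕ} {x : ExtAlg n} (hx : x ∈ antighostGE (n := n) k) :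
    euler x ∈ antighostGE (n := n) k :=
  antighostGE_map _ (fun _ l hk _ hx => bidegree_le_antighostGE l hk (euler_mem_bidegree hx)) hx

theorem euler_mem_ghostNumber {g : ℤ} {x : ExtAlg n} (hx : x ∈ ghostNumber (n := n) g) :
    euler x ∈ ghostNumber (n := n) g :=
  ghostNumber_map _ (fun _ _ hk _ hx => bidegree_le_ghostNumber hk (euler_mem_bidegree hx)) hx

theorem koszulHomotopy_mem_antighostGE {k : ℕ} {x : ExtAlg n}
    (hx : x ∈ antighostGE (n := n) k) : koszulHomotopy x ∈ antighostGE (n := n) (k + 1) := by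
  rw [koszulHomotopy_apply, add_comm]
  exact Submodule.sum_mem _ fun a _ =>
    mul_mem_antighostGE (ghostMom_mem_antighostGE a) (dG_mem_antighostGE a hx)

theorem koszulHomotopy_mem_ghostNumber {g : ℤ} {x : ExtAlg n}
    (hx : x ∈ ghostNumber (n := n) g) : koszulHomotopy x ∈ ghostNumber (n := n) (g - 1) := by
  rw [koszulHomotopy_apply, sub_eq_neg_add]
  exact Submodule.sum_mem _ fun a _ =>
    mul_mem_ghostNumber (ghostMom_mem_ghostNumber a) (dG_mem_ghostNumber a hx)

/-! ### Projection to the ghosts and the homotopy -/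

/-- The homomorphism `π` from the extended algebra to `ℂ(η^a)` that sets `G_a` and `𝒫_a` to
zero. -/
noncomputable def projEta : ExtAlg n →ₐ[ℂ] EtaAlg n :=
  Algebra.TensorProduct.lift
    ((Algebra.ofId ℂ (EtaAlg n)).comp (MvPolynomial.aeval (0 : Fin n → ℂ)))
    (ExteriorAlgebra.map (LinearMap.funLeft ℂ ℂ Sum.inr))
    (fun f w => by
      change algebraMap ℂ (EtaAlg n) (MvPolynomial.aeval 0 f) * _ = _
      exact Algebra.commutes _ _)

/-- The inclusion of `ℂ(η^a)` into the extended algebra. -/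
noncomputable def inclEta : EtaAlg n →ₐ[ℂ] ExtAlg n :=
  Algebra.TensorProduct.includeRight.comp (ExteriorAlgebra.map
    (LinearMap.pi (Sum.elim (fun _ => 0) LinearMap.proj)))

theorem projEta_ofPoly (f : MvPolynomial (Fin n) ℂ) :
    projEta (ofPoly f) = algebraMap ℂ _ (MvPolynomial.eval 0 f) := by
  rw [ofPoly, projEta, Algebra.TensorProduct.lift_tmul, map_one, mul_one]
  rfl

theorem projEta_ghostVar (i : Fin n ⊕ Fin n) : projEta (ghostVar i)
    = ExteriorAlgebra.ι ℂ (LinearMap.funLeft ℂ ℂ Sum.inr (Pi.single i 1)) := by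
  rw [ghostVar, projEta, Algebra.TensorProduct.lift_tmul, map_one, one_mul,
    ExteriorAlgebra.map_apply_ι]

theorem projEta_ghostMom (a : Fin n) : projEta (ghostMom a) = 0 := by
  rw [ghostMom, projEta_ghostVar,
    show LinearMap.funLeft ℂ ℂ Sum.inr (Pi.single (Sum.inl a : Fin n ⊕ Fin n) (1 : ℂ)) = 0 by
      ext b; simp [LinearMap.funLeft_apply], map_zero]

theorem projEta_ghost (a : Fin n) : projEta (ghost a) = eta a := by
  rw [ghost, projEta_ghostVar, eta]
  congr 1
  ext b
  simp [LinearMap.funLeft_apply, Pi.single_apply]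

theorem projEta_genG (a : Fin n) : projEta (genG a) = 0 := by
  rw [genG, projEta_ofPoly, MvPolynomial.eval_X, Pi.zero_apply, map_zero]

theorem inclEta_eta (a : Fin n) : inclEta (eta a) = ghost a := by
  rw [inclEta, eta, AlgHom.comp_apply, ExteriorAlgebra.map_apply_ι,
    Algebra.TensorProduct.includeRight_apply, ghost, ghostVar]
  congr 2
  ext i
  cases i <;> simp [Pi.single_apply]

theorem ι_eq_sum_eta (v : Fin n → ℂ) : ExteriorAlgebra.ι ℂ v = ∑ a, v a • eta a := by
  conv_lhs => rw [← Finset.univ_sum_single v]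
  rw [map_sum]
  refine Finset.sum_congr rfl fun a _ => ?_
  rw [eta, ← map_smul, ← Pi.single_smul, smul_eq_mul, mul_one]

theorem EtaAlg.induction {P : EtaAlg n → Prop} (h₀ : ∀ r : ℂ, P (algebraMap ℂ _ r))
    (h_add : ∀ x y, P x → P y → P (x + y)) (h_smul : ∀ (c : ℂ) x, P x → P (c • x))
    (h_mul : ∀ a x, P x → P (eta a * x)) :
    ∀ x, P x := by
  intro x
  induction x using extAlg_left_induction with
  | h₀ r => exact h₀ r
  | h_add x y hx hy => exact h_add x y hx hy
  | h_mul x v hx =>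
    rw [ι_eq_sum_eta, Finset.sum_mul]
    refine Finset.sum_induction _ P h_add (by simpa using h₀ 0) fun a _ => ?_
    rw [smul_mul_assoc]
    exact h_smul _ _ (h_mul a x hx)

theorem projEta_inclEta (w : EtaAlg n) : projEta (inclEta w) = w := by
  induction w using EtaAlg.induction with
  | h₀ r => rw [AlgHom.commutes, AlgHom.commutes]
  | h_add x y hx hy => rw [map_add, map_add, hx, hy]
  | h_smul c x hx => rw [map_smul, map_smul, hx]
  | h_mul a x hx => rw [map_mul, map_mul, hx, inclEta_eta, projEta_ghost]

theorem projEta_of_mem_antighostGE_one {x : ExtAlg n} (hx : x ∈ antighostGE (n := n) 1) :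
    projEta x = 0 := by
  have h : antighostGE (n := n) 1 ≤ LinearMap.ker projEta.toLinearMap :=
    antighostGE_le fun k l hk x hx => by
      rw [LinearMap.mem_ker, AlgHom.toLinearMap_apply]
      induction hx using bidegree_induction with
      | h₀ f => simp at hk
      | h_add k l x y _ _ hx hy => rw [map_add, hx hk, hy hk, add_zero]
      | h_mom k l x a _ hx => rw [map_mul, projEta_ghostMom, zero_mul]
      | h_ghost l x a _ hx => simp at hk
      | h_zero k l => simp
  exact h hx

theorem projEta_koszulHomotopy (x : ExtAlg n) : projEta (koszulHomotopy x) = 0 := by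
  rw [koszulHomotopy_apply, map_sum]
  exact Finset.sum_eq_zero fun a _ => by rw [map_mul, projEta_ghostMom, zero_mul]

theorem projEta_euler (x : ExtAlg n) : projEta (euler x) = 0 := by
  rw [euler_apply, map_sum]
  exact Finset.sum_eq_zero fun a _ => by
    rw [map_add, map_mul, map_mul, projEta_genG, projEta_ghostMom, zero_mul, zero_mul, add_zero]

theorem projEta_parity (x : ExtAlg n) :
    projEta (parity x) = extInvolute _ (projEta x) := by
  induction x using ExtAlg.induction with
  | h₀ f => rw [parity_ofPoly, projEta_ofPoly, AlgHom.commutes]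
  | h_add x y hx hy => rw [map_add, map_add, hx, hy, map_add, map_add]
  | h_mul i x hx =>
    rw [map_mul, parity_ghostVar, map_mul, map_neg, hx, map_mul, map_mul, projEta_ghostVar,
      extInvolute_ι]

/-- A subspace stable under the Euler operator is stable under polynomials in it. -/
theorem aeval_mem_of_mapsTo {V : Type*} [AddCommGroup V] [Module ℂ V] {E : V →ₗ[ℂ] V}
    {N : Submodule ℂ V} (hE : ∀ x ∈ N, E x ∈ N) (p : Polynomial ℂ) {x : V} (hx : x ∈ N) :
    (Polynomial.aeval E p) x ∈ N := by
  induction p using Polynomial.induction_on' with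
  | add p q hp hq => rw [map_add]; exact N.add_mem hp hq
  | monomial k c =>
    rw [Polynomial.aeval_monomial]
    refine N.smul_mem c ?_
    induction k with
    | zero => exact hx
    | succ k ih => rw [pow_succ']; exact hE _ ih

theorem aeval_commute {V : Type*} [AddCommGroup V] [Module ℂ V] {E d : V →ₗ[ℂ] V}
    (h : ∀ x, E (d x) = d (E x)) (p : Polynomial ℂ) (x : V) :
    (Polynomial.aeval E p) (d x) = d ((Polynomial.aeval E p) x) := by
  have hc : Commute E d := LinearMap.ext h
  have hp : Commute (Polynomial.aeval E p) d := by
    induction p using Polynomial.induction_on' with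
    | add p q hp hq => rw [map_add]; exact hp.add_left hq
    | monomial k c =>
      rw [Polynomial.aeval_monomial]
      exact (show Commute _ d from Algebra.commutes c d).mul_left (hc.pow_left k)
  exact LinearMap.congr_fun hp.eq x

/-- The elements of `ℂ(η^a)`, described inside the extended algebra. -/
noncomputable def etaPart : Submodule ℂ (ExtAlg n) :=
  LinearMap.ker (inclEta.toLinearMap ∘ₗ projEta.toLinearMap - LinearMap.id)

theorem mem_etaPart {x : ExtAlg n} : x ∈ etaPart (n := n) ↔ inclEta (projEta x) = x := by
  simp [etaPart, sub_eq_zero]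

/-- The sum of the subspaces of positive degree in the `G_a` and `𝒫_a`. -/
noncomputable def eulerPos : Submodule ℂ (ExtAlg n) :=
  ⨆ d : ℕ, Module.End.eigenspace (euler (n := n)) ((d : ℂ) + 1)

theorem sup_eulerPos_le_comap (T : ExtAlg n →ₗ[ℂ] ExtAlg n) (N : Submodule ℂ (ExtAlg n))
    (h₀ : ∀ x ∈ etaPart, euler x = 0 → T x ∈ N)
    (h : ∀ (d : ℕ) x, euler x = ((d : ℂ) + 1) • x → T x ∈ N) :
    (etaPart ⊓ LinearMap.ker euler) ⊔ eulerPos ≤ N.comap T := by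
  refine sup_le (fun x hx => h₀ x hx.1 hx.2) (iSup_le fun d x hx => h d x ?_)
  exact Module.End.mem_eigenspace_iff.mp hx

theorem mem_eulerPos {d : ℕ} {x : ExtAlg n} (hx : euler x = ((d : ℂ) + 1) • x) :
    x ∈ eulerPos (n := n) :=
  Submodule.mem_iSup_of_mem d (Module.End.mem_eigenspace_iff.mpr hx)

/-- The extended algebra is the sum of `ℂ(η^a)`, where the Euler operator vanishes, and of its
eigenspaces for positive eigenvalues. -/
theorem etaPart_sup_eulerPos (x : ExtAlg n) :
    x ∈ (etaPart ⊓ LinearMap.ker euler) ⊔ eulerPos (n := n) := by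
  set S := (etaPart ⊓ LinearMap.ker euler) ⊔ eulerPos (n := n) with hS
  have hpos : ∀ {d : ℕ} {x : ExtAlg n}, euler x = ((d : ℂ) + 1) • x → x ∈ S :=
    fun hx => (le_sup_right : eulerPos ≤ S) (mem_eulerPos hx)
  -- Multiplication by a generator shifts the Euler degree by one or zero.
  have hshift : ∀ y : ExtAlg n, (∀ x, euler (y * x) = y * x + y * euler x) →
      ∀ x ∈ S, y * x ∈ S := by
    intro y hy x hx
    refine sup_eulerPos_le_comap (LinearMap.mulLeft ℂ y) S (fun x _ hx => hpos (d := 0) ?_)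
      (fun d x hx => hpos (d := d + 1) ?_) hx
    · rw [LinearMap.mulLeft_apply, hy, hx, mul_zero, add_zero]
      simp
    · rw [LinearMap.mulLeft_apply, hy, hx, mul_smul_comm]
      push_cast
      module
  induction x using ExtAlg.induction with
  | h₀ f =>
    induction f using MvPolynomial.induction_on with
    | C c =>
      refine (le_sup_left : _ ≤ S) ⟨mem_etaPart.2 ?_, ?_⟩
      · rw [projEta_ofPoly, MvPolynomial.eval_C, AlgHom.commutes]
        rfl
      · change euler _ = 0
        rw [euler_apply]
        refine Finset.sum_eq_zero fun a _ => ?_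
        rw [dG_ofPoly, dLeft_ofPoly, MvPolynomial.pderiv_C, ofPoly, TensorProduct.zero_tmul,
          mul_zero, mul_zero, add_zero]
    | add f g hf hg => rw [ofPoly_add]; exact S.add_mem hf hg
    | mul_X f a hf =>
      rw [mul_comm, ofPoly_mul]
      exact hshift (genG a) (euler_genG_mul a) _ hf
  | h_add x y hx hy => exact S.add_mem hx hy
  | h_mul i x hx =>
    cases i with
    | inl a => exact hshift (ghostMom a) (euler_ghostMom_mul a) _ hx
    | inr a =>
      refine sup_eulerPos_le_comap (LinearMap.mulLeft ℂ (ghost a)) S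
        (fun x hx hx' => (le_sup_left : _ ≤ S) ⟨mem_etaPart.2 ?_, ?_⟩)
        (fun d x hx => hpos (d := d) ?_) hx
      · rw [LinearMap.mulLeft_apply, map_mul, map_mul, projEta_ghost, inclEta_eta,
          mem_etaPart.1 hx]
      · change euler _ = 0
        rw [LinearMap.mulLeft_apply, euler_ghost_mul, hx', mul_zero]
      · rw [LinearMap.mulLeft_apply, euler_ghost_mul, hx, mul_smul_comm]

theorem exists_polynomial_of_mem_eulerPos {x : ExtAlg n} (hx : x ∈ eulerPos (n := n)) :
    ∃ p : Polynomial ℂ, p.coeff 0 ≠ 0 ∧ Polynomial.aeval euler p x = 0 := by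
  induction hx using Submodule.iSup_induction' with
  | mem d x hx =>
    refine ⟨Polynomial.X - Polynomial.C ((d : ℂ) + 1), ?_, ?_⟩
    · rw [Polynomial.coeff_sub, Polynomial.coeff_X_zero, Polynomial.coeff_C_zero, zero_sub,
        neg_ne_zero]
      exact Nat.cast_add_one_ne_zero d
    · rw [map_sub, Polynomial.aeval_X, Polynomial.aeval_C, LinearMap.sub_apply,
        Module.End.mem_eigenspace_iff.mp hx, Module.algebraMap_end_apply, sub_self]
  | zero => exact ⟨1, by simp, map_zero _⟩
  | add x y _ _ hx hy =>
    obtain ⟨p, hp, hpx⟩ := hx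
    obtain ⟨q, hq, hqy⟩ := hy
    refine ⟨p * q, by rw [Polynomial.mul_coeff_zero]; exact mul_ne_zero hp hq, ?_⟩
    have hx : Polynomial.aeval euler (p * q) x = 0 := by
      rw [mul_comm, map_mul, Module.End.mul_apply, hpx, map_zero]
    have hy : Polynomial.aeval euler (p * q) y = 0 := by
      rw [map_mul, Module.End.mul_apply, hqy, map_zero]
    rw [map_add, hx, hy, add_zero]

/-- On the kernel of `π` the Euler operator is inverted by polynomials in itself. -/
theorem exists_polynomial_euler_inverse {x : ExtAlg n} (hx : projEta x = 0) :
    ∃ p : Polynomial ℂ, euler (Polynomial.aeval euler p x) = x := by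
  -- An element annihilated by a polynomial with nonzero constant term is in the range.
  have hinv : ∀ {y : ExtAlg n} {p : Polynomial ℂ}, p.coeff 0 ≠ 0 →
      Polynomial.aeval euler p y = 0 →
      ∃ q : Polynomial ℂ, euler (Polynomial.aeval euler q y) = y := by
    intro y p hp hpy
    refine ⟨Polynomial.C (-(p.coeff 0)⁻¹) * p.divX, ?_⟩
    have h := Polynomial.divX_mul_X_add p
    rw [← h, map_add, mul_comm, map_mul, Polynomial.aeval_X, Polynomial.aeval_C,
      LinearMap.add_apply, Module.End.mul_apply, Module.algebraMap_end_apply] at hpy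
    rw [map_mul, Polynomial.aeval_C, Module.End.mul_apply, Module.algebraMap_end_apply, map_smul,
      eq_neg_of_add_eq_zero_left hpy, smul_neg, neg_smul, neg_neg, smul_smul, inv_mul_cancel₀ hp,
      one_smul]
  obtain ⟨x₀, hx₀, x₁, hx₁, rfl⟩ := Submodule.mem_sup.1 (etaPart_sup_eulerPos x)
  obtain ⟨p, hp, hpx⟩ := exists_polynomial_of_mem_eulerPos hx₁
  have hx₁' : projEta x₁ = 0 := by
    obtain ⟨q, hq⟩ := hinv hp hpx
    rw [← hq, projEta_euler]
  have hx₀' : x₀ = 0 := by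
    rw [map_add, hx₁', add_zero] at hx
    rw [← mem_etaPart.1 hx₀.1, hx, map_zero]
  rw [hx₀', zero_add]
  exact hinv hp hpx

/-! ### The perturbation step -/

/-- The leading part of the BRST derivation in the antighost filtration is the Koszul
differential. -/
theorem gradedBracket_add_koszul_mem {Ω : ExtAlg n}
    (hΩ : Ω - ∑ a, genG a * ghost a ∈ antighostGE (n := n) 1) {k : ℕ} {x : ExtAlg n}
    (hx : x ∈ antighostGE (n := n) k) :
    gradedBracket A x Ω + parity (koszul x) ∈ antighostGE (n := n) k := by
  have hη : ∀ a, dLeft (Sum.inr a) Ω - genG a ∈ antighostGE (n := n) 1 := fun a => by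
    have h := dLeft_inr_mem_antighostGE a hΩ
    rw [map_sub, map_sum] at h
    have h' : ∀ b, dLeft (Sum.inr a) (genG b * ghost b) = if a = b then genG b else 0 := fun b => by
      rw [genG, dLeft_ofPoly_mul, ghost, dLeft_ghostVar]
      simp only [Sum.inr.injEq, mul_ite, mul_one, mul_zero]
    simpa only [h', Finset.sum_ite_eq, Finset.mem_univ, if_true] using h
  have h : gradedBracket A x Ω + parity (koszul x) = ∑ a, dG a x * bracketG A a Ω
      - ∑ a, parity (dLeft (Sum.inl a) x) * (dLeft (Sum.inr a) Ω - genG a)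
      - ∑ a, parity (dLeft (Sum.inr a) x) * dLeft (Sum.inl a) Ω := by
    have h' : ∀ a, genG a * parity (dLeft (Sum.inl a) x)
        = parity (dLeft (Sum.inl a) x) * genG a := fun a => ofPoly_comm _ _
    rw [gradedBracket_apply, Fintype.sum_sum_type, koszul_apply, map_sum]
    simp only [map_mul, mul_sub, Finset.sum_sub_distrib, Sum.swap_inl, Sum.swap_inr]
    simp only [← h']
    simp only [genG, parity_ofPoly]
    abel
  rw [h]
  refine Submodule.sub_mem _ (Submodule.sub_mem _ ?_ ?_) ?_
  · exact Submodule.sum_mem _ fun a _ => mul_mem_antighostGE_left (dG_mem_antighostGE a hx) _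
  · refine Submodule.sum_mem _ fun a _ => ?_
    cases k with
    | zero => exact mem_antighostGE_zero _
    | succ k =>
      exact mul_mem_antighostGE (parity_mem_antighostGE (dLeft_inl_mem_antighostGE a hx)) (hη a)
  · exact Submodule.sum_mem _ fun a _ =>
      mul_mem_antighostGE_left (parity_mem_antighostGE (dLeft_inr_mem_antighostGE a hx)) _

/-- One step of homological perturbation theory: if `x` has antighost number at least `k` and is
closed up to terms of the same antighost number, then it is exact up to terms of higher antighost
number. The subspaces `N` and `N'` keep track of the ghost numbers. -/
theorem exists_primitive_step {Ω : ExtAlg n}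
    (hΩ : Ω - ∑ a, genG a * ghost a ∈ antighostGE (n := n) 1) {N N' : Submodule ℂ (ExtAlg n)}
    (hE : ∀ x ∈ N, euler x ∈ N) (hh : ∀ x ∈ N, koszulHomotopy x ∈ N')
    (hp : ∀ x ∈ N', parity x ∈ N') {k : ℕ} {x : ExtAlg n} (hx : x ∈ antighostGE (n := n) k)
    (hxN : x ∈ N) (hπ : projEta x = 0) (hs : gradedBracket A x Ω ∈ antighostGE (n := n) k) :
    ∃ y ∈ antighostGE (n := n) (k + 1), y ∈ N' ∧ projEta y = 0 ∧
      x + gradedBracket A y Ω ∈ antighostGE (n := n) (k + 1) := by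
  have hδ : koszul x ∈ antighostGE (n := n) k := by
    have h := Submodule.sub_mem _ (gradedBracket_add_koszul_mem A hΩ hx) hs
    rw [add_sub_cancel_left] at h
    simpa using parity_mem_antighostGE h
  obtain ⟨p, hpx⟩ := exists_polynomial_euler_inverse hπ
  set u := Polynomial.aeval euler p x with hu
  have hδu : koszul u ∈ antighostGE (n := n) k := by
    rw [hu, ← aeval_commute euler_koszul]
    exact aeval_mem_of_mapsTo (fun x hx => euler_mem_antighostGE hx) p hδ
  have huk : u ∈ antighostGE (n := n) k :=
    aeval_mem_of_mapsTo (fun x hx => euler_mem_antighostGE hx) p hx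
  have hy := koszulHomotopy_mem_antighostGE huk
  refine ⟨-parity (koszulHomotopy u), Submodule.neg_mem _ (parity_mem_antighostGE hy),
    N'.neg_mem (hp _ (hh _ (aeval_mem_of_mapsTo hE p hxN))), ?_, ?_⟩
  · rw [map_neg, projEta_parity, projEta_koszulHomotopy, map_zero, neg_zero]
  · have h := gradedBracket_add_koszul_mem A hΩ
      (Submodule.neg_mem _ (parity_mem_antighostGE hy))
    have h' := Submodule.add_mem _ h (koszulHomotopy_mem_antighostGE hδu)
    rw [map_neg koszul, koszul_parity, neg_neg, parity_parity, add_assoc,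
      koszul_koszulHomotopy_add, hpx] at h'
    rw [add_comm x]
    exact h'

/-! ### The projection as a chain map -/

theorem projEta_dLeft_inr (a : Fin n) (x : ExtAlg n) :
    projEta (dLeft (Sum.inr a) x) = extContract (LinearMap.proj a) (projEta x) := by
  induction x using ExtAlg.induction with
  | h₀ f =>
    rw [dLeft_ofPoly, projEta_ofPoly, map_zero, Algebra.algebraMap_eq_smul_one, map_smul,
      extContract_one, smul_zero]
  | h_add x y hx hy => simp only [map_add, hx, hy]
  | h_mul i x hx =>
    rw [dLeft_mul, map_add, map_mul, map_mul, hx, map_mul, dLeft_ghostVar, parity_ghostVar,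
      map_neg, projEta_ghostVar, extContract_ι_mul, LinearMap.proj_apply,
      LinearMap.funLeft_apply, Pi.single_apply, neg_mul, ← sub_eq_add_neg]
    split_ifs <;> simp

theorem extContract_eta (a b : Fin n) :
    extContract (LinearMap.proj a) (eta b) = if a = b then 1 else 0 := by
  rw [eta, extContract_ι, LinearMap.proj_apply, Pi.single_apply]
  split_ifs <;> simp

theorem projEta_bracketG (a : Fin n) (y : ExtAlg n) : projEta (bracketG A a y) = 0 := by
  rw [bracketG, map_sum]
  refine Finset.sum_eq_zero fun b _ => ?_
  rw [map_mul, projEta_ofPoly, A.eval_zero_C, map_zero, zero_mul]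

section Leading

variable {Ω : ExtAlg n}

theorem projEta_eq_zero_of_leading
    (hΩ : Ω - ∑ a, genG a * ghost a ∈ antighostGE (n := n) 1) :
    projEta Ω = 0 := by
  have h := projEta_of_mem_antighostGE_one hΩ
  rw [map_sub, map_sum, sub_eq_zero] at h
  rw [h]
  exact Finset.sum_eq_zero fun a _ => by rw [map_mul, projEta_genG, zero_mul]

theorem projEta_dG_of_leading
    (hΩ : Ω - ∑ a, genG a * ghost a ∈ antighostGE (n := n) 1) (c : Fin n) :
    projEta (dG c Ω) = eta c := by
  have h := projEta_of_mem_antighostGE_one (dG_mem_antighostGE c hΩ)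
  rw [map_sub, map_sub, sub_eq_zero] at h
  rw [h, map_sum, map_sum, Finset.sum_eq_single c]
  · rw [dG_genG_mul, if_pos rfl, map_add, map_mul, projEta_genG, zero_mul, add_zero, projEta_ghost]
  · intro b _ hb
    rw [dG_genG_mul, if_neg hb.symm, zero_add, map_mul, projEta_genG, zero_mul]
  · simp

/-- At `G = 𝒫 = 0` only the terms of `Ω` linear in the ghost momenta contribute to `[x, Ω]`. -/
theorem projEta_gradedBracket
    (hΩ : Ω - ∑ a, genG a * ghost a ∈ antighostGE (n := n) 1)
    (hodd : parity Ω = -Ω) (x : ExtAlg n) :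
    projEta (gradedBracket A x Ω) = ∑ a, projEta (dLeft (Sum.inl a) Ω)
      * extContract (LinearMap.proj a) (extInvolute _ (projEta x)) := by
  have h₁ : ∀ a, projEta (dLeft (Sum.inr a) Ω) = 0 := fun a => by
    rw [projEta_dLeft_inr, projEta_eq_zero_of_leading hΩ, map_zero]
  have h₂ : ∀ a, projEta (parity (dLeft (Sum.inr a) x) * dLeft (Sum.inl a) Ω)
      = -(projEta (dLeft (Sum.inl a) Ω)
        * extContract (LinearMap.proj a) (extInvolute _ (projEta x))) := fun a => by
    rw [← even_mul_comm (parity_dLeft_of_odd hodd _), map_mul, ← projEta_parity,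
      ← projEta_dLeft_inr, dLeft_parity, map_neg, mul_neg, neg_neg]
  rw [gradedBracket_apply, Fintype.sum_sum_type, map_sub, map_add, map_sum, map_sum, map_sum]
  simp only [Sum.swap_inl, Sum.swap_inr, h₂]
  rw [Finset.sum_eq_zero fun a _ => by rw [map_mul, projEta_bracketG, mul_zero],
    Finset.sum_eq_zero fun a _ => by rw [map_mul, h₁, mul_zero], Finset.sum_neg_distrib]
  abel

end Leading

/-! ### Existence of the BRST generator -/

/-- The obstruction `[Ω, Ω]` is moved to higher and higher antighost number. -/
theorem exists_approximate_generator (k : ℕ) : ∃ Ω ∈ ghostNumber (n := n) 1,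
    Ω - ∑ a, genG a * ghost a ∈ antighostGE (n := n) 1 ∧
      gradedBracket A Ω Ω ∈ antighostGE (n := n) k := by
  induction k with
  | zero =>
    refine ⟨∑ a, genG a * ghost a, Submodule.sum_mem _ fun a _ => ?_, ?_, mem_antighostGE_zero _⟩
    · have h : genG a * ghost a ∈ ghostNumber (n := n) (0 + 1) :=
        mul_mem_ghostNumber (ofPoly_mem_ghostNumber _) (ghost_mem_ghostNumber a)
      rwa [zero_add] at h
    · rw [sub_self]
      exact Submodule.zero_mem _
  | succ k ih =>
    obtain ⟨Ω, hgh, hlead, hk⟩ := ih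
    have hodd := parity_of_mem_ghostNumber_one hgh
    have hR := gradedBracket_mem_ghostNumber A hgh hgh
    obtain ⟨y, hyk, hyN, -, hy⟩ := exists_primitive_step A hlead (N := ghostNumber (1 + 1))
      (N' := ghostNumber 1) (fun x hx => euler_mem_ghostNumber hx)
      (fun x hx => by
        have h := koszulHomotopy_mem_ghostNumber hx
        rwa [add_sub_cancel_right] at h)
      (fun x hx => parity_mem_ghostNumber hx) hk hR
      (by
        rw [projEta_gradedBracket A hlead hodd, projEta_eq_zero_of_leading hlead]
        exact Finset.sum_eq_zero fun a _ => by rw [map_zero, map_zero, mul_zero])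
      (by rw [gradedBracket_gradedBracket_self A hodd]; exact Submodule.zero_mem _)
    -- The factor `1 / 2` compensates the two equal cross terms `[Ω, y]` and `[y, Ω]`.
    refine ⟨Ω + (1 / 2 : ℂ) • y, Submodule.add_mem _ hgh (Submodule.smul_mem _ _ hyN), ?_, ?_⟩
    · rw [add_sub_right_comm]
      exact Submodule.add_mem _ hlead
        (Submodule.smul_mem _ _ (antighostGE_anti (Nat.le_add_left 1 k) hyk))
    · have h : gradedBracket A (Ω + (1 / 2 : ℂ) • y) (Ω + (1 / 2 : ℂ) • y)
          = (gradedBracket A Ω Ω + gradedBracket A y Ω) + (1 / 4 : ℂ) • gradedBracket A y y := by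
        simp only [map_add, map_smul, LinearMap.add_apply, LinearMap.smul_apply]
        rw [gradedBracket_symm_of_odd A hodd (parity_of_mem_ghostNumber_one hyN)]
        module
      rw [h]
      exact Submodule.add_mem _ hy
        (Submodule.smul_mem _ _ (gradedBracket_self_mem_antighostGE A hyk))

theorem exists_isBRSTGenerator : ∃ Ω : ExtAlg n, IsBRSTGenerator A Ω := by
  obtain ⟨Ω, hgh, hlead, h⟩ := exists_approximate_generator A (n + 1)
  rw [antighostGE_eq_bot, Submodule.mem_bot] at h
  exact ⟨Ω, hgh, hlead, h⟩

/-! ### The cohomology of the BRST derivation -/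

theorem brst_apply (Ω x : ExtAlg n) : brst A Ω x = gradedBracket A x Ω := rfl

theorem sPrime_apply (w : EtaAlg n) : sPrime A w
    = ∑ a, ∑ b, ∑ c, ((1 / 2 : ℂ) * A.structConst a b c) •
      (eta b * eta c * extContract (LinearMap.proj a) w) := by
  simp only [sPrime, LinearMap.sum_apply, LinearMap.smul_apply, LinearMap.comp_apply,
    LinearMap.mulLeft_apply]

theorem sPrime_extInvolute (w : EtaAlg n) :
    sPrime A (extInvolute _ w) = -extInvolute _ (sPrime A w) := by
  rw [sPrime_apply, sPrime_apply]
  simp only [map_sum, map_smul, map_mul, ← Finset.sum_neg_distrib]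
  refine Finset.sum_congr rfl fun a _ => Finset.sum_congr rfl fun b _ =>
    Finset.sum_congr rfl fun c _ => ?_
  rw [show extContract (LinearMap.proj a) (extInvolute _ w)
      = -extInvolute _ (extContract (LinearMap.proj a) w) from contractLeft_involute _ w,
    eta, eta, extInvolute_ι, extInvolute_ι, neg_mul_neg, mul_neg, smul_neg]

theorem extInvolute_extInvolute (w : EtaAlg n) :
    extInvolute _ (extInvolute _ w) = w := CliffordAlgebra.involute_involute w

section Generator

variable {A} {Ω : ExtAlg n}

theorem IsBRSTGenerator.parity_eq (hΩ : IsBRSTGenerator A Ω) : parity Ω = -Ω :=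
  parity_of_mem_ghostNumber_one hΩ.ghost_one

theorem IsBRSTGenerator.brst_brst (hΩ : IsBRSTGenerator A Ω) (x : ExtAlg n) :
    brst A Ω (brst A Ω x) = 0 := by
  have h := two_smul_gradedBracket_gradedBracket A hΩ.parity_eq x
  rw [hΩ.nilpotent, map_zero] at h
  exact (smul_eq_zero.mp h).resolve_left two_ne_zero

/-- The component of a BRST generator linear in the ghost momenta is determined at `G = 0` by the
terms linear in the `G_a` of the equation `[Ω, Ω] = 0`. -/
theorem IsBRSTGenerator.projEta_dLeft_inl (hΩ : IsBRSTGenerator A Ω) (c : Fin n) :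
    projEta (dLeft (Sum.inl c) Ω)
      = ∑ a, ∑ b, ((1 / 2 : ℂ) * A.structConst c a b) • (eta a * eta b) := by
  have h := congrArg projEta (dG_gradedBracket_self A hΩ.parity_eq c)
  have hlead := hΩ.leading
  rw [← antighostGE_one] at hlead
  rw [hΩ.nilpotent, map_zero, map_zero, map_add, map_smul,
    projEta_gradedBracket A hlead hΩ.parity_eq, projEta_dG_of_leading hlead, map_sum] at h
  have h₁ : ∀ a, extContract (LinearMap.proj a) (extInvolute _ (eta c))
      = if a = c then (-1 : EtaAlg n) else 0 := fun a => by
    rw [eta, extInvolute_ι, map_neg, ← eta, extContract_eta]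
    split_ifs <;> simp
  have h₂ : ∀ a b, projEta (ofPoly (MvPolynomial.pderiv c (A.C a b)) * (dG a Ω * dG b Ω))
      = A.structConst c a b • (eta a * eta b) := fun a b => by
    rw [map_mul, map_mul, projEta_ofPoly, projEta_dG_of_leading hlead,
      projEta_dG_of_leading hlead, ← Algebra.smul_def]
    rfl
  simp only [h₁, map_sum, h₂, mul_ite, mul_neg, mul_one, mul_zero, Finset.sum_ite_eq',
    Finset.mem_univ, if_true] at h
  rw [smul_neg, eq_comm, neg_add_eq_zero] at h
  simp only [mul_smul, ← Finset.smul_sum]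
  rw [← h, smul_smul]
  norm_num

/-- The projection `π` is a chain map up to the grading automorphism, which turns the left
derivation `s'` into a right derivation. -/
theorem IsBRSTGenerator.projEta_brst (hΩ : IsBRSTGenerator A Ω) (x : ExtAlg n) :
    projEta (brst A Ω x) = sPrime A (extInvolute _ (projEta x)) := by
  rw [brst_apply, projEta_gradedBracket A hΩ.leading hΩ.parity_eq, sPrime_apply]
  refine Finset.sum_congr rfl fun a _ => ?_
  simp only [hΩ.projEta_dLeft_inl, Finset.sum_mul, smul_mul_assoc]

/-- The kernel of `π` is acyclic; the subspaces `N` and `N'` keep track of the ghost number. -/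
theorem IsBRSTGenerator.exists_primitive (hΩ : IsBRSTGenerator A Ω)
    {N N' : Submodule ℂ (ExtAlg n)}
    (hE : ∀ x ∈ N, euler x ∈ N) (hh : ∀ x ∈ N, koszulHomotopy x ∈ N')
    (hp : ∀ x ∈ N', parity x ∈ N') (hs : ∀ x ∈ N', brst A Ω x ∈ N) {x : ExtAlg n}
    (hxN : x ∈ N) (hπ : projEta x = 0) (hx : brst A Ω x = 0) :
    ∃ y ∈ N', projEta y = 0 ∧ brst A Ω y = x := by
  have h : ∀ k, ∃ y ∈ N', projEta y = 0 ∧ x - brst A Ω y ∈ antighostGE (n := n) k := by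
    intro k
    induction k with
    | zero => exact ⟨0, N'.zero_mem, map_zero _, mem_antighostGE_zero _⟩
    | succ k ih =>
      obtain ⟨y, hyN, hyπ, hy⟩ := ih
      have hclosed : brst A Ω (x - brst A Ω y) = 0 := by
        rw [map_sub, hx, hΩ.brst_brst, sub_zero]
      obtain ⟨z, -, hzN, hzπ, hz⟩ := exists_primitive_step A hΩ.leading hE hh hp hy
        (N.sub_mem hxN (hs y hyN))
        (by rw [map_sub, hπ, hΩ.projEta_brst, hyπ, map_zero, map_zero, sub_zero])
        (by
          rw [← brst_apply, hclosed]
          exact Submodule.zero_mem _)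
      refine ⟨y - z, N'.sub_mem hyN hzN, by rw [map_sub, hyπ, hzπ, sub_zero], ?_⟩
      rw [map_sub, ← sub_add]
      exact hz
  obtain ⟨y, hyN, hyπ, hy⟩ := h (n + 1)
  rw [antighostGE_eq_bot, Submodule.mem_bot, sub_eq_zero] at hy
  exact ⟨y, hyN, hyπ, hy.symm⟩

theorem IsBRSTGenerator.brst_mem_ghostNumber (hΩ : IsBRSTGenerator A Ω) {g : ℤ}
    {x : ExtAlg n} (hx : x ∈ ghostNumber (n := n) g) :
    brst A Ω x ∈ ghostNumber (n := n) (g + 1) := by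
  rw [brst_apply]
  exact gradedBracket_mem_ghostNumber A hx hΩ.ghost_one

/-- A cocycle of `s'` lifts to a cocycle of the BRST derivation, because the failure of `inclEta w`
to be one lies in the acyclic subspace `ker π`. -/
theorem IsBRSTGenerator.exists_lift (hΩ : IsBRSTGenerator A Ω)
    {N N' : Submodule ℂ (ExtAlg n)}
    (hE : ∀ x ∈ N, euler x ∈ N) (hh : ∀ x ∈ N, koszulHomotopy x ∈ N')
    (hp : ∀ x ∈ N', parity x ∈ N') (hs : ∀ x ∈ N', brst A Ω x ∈ N) {w : EtaAlg n}
    (hw : sPrime A w = 0) (hwN : inclEta w ∈ N') :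
    ∃ x ∈ N', projEta x = w ∧ brst A Ω x = 0 := by
  obtain ⟨y, hyN, hyπ, hy⟩ := hΩ.exists_primitive hE hh hp hs (hs _ hwN)
    (by rw [hΩ.projEta_brst, projEta_inclEta, sPrime_extInvolute, hw, map_zero, neg_zero])
    (hΩ.brst_brst _)
  exact ⟨inclEta w - y, N'.sub_mem hwN hyN, by rw [map_sub, projEta_inclEta, hyπ, sub_zero],
    by rw [map_sub, hy, sub_self]⟩

end Generator

/-- The square of the BRST derivation vanishes, and `π` is surjective. -/
theorem sPrime_sPrime (w : EtaAlg n) :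
    sPrime A (sPrime A w) = 0 := by
  obtain ⟨Ω, hΩ⟩ := exists_isBRSTGenerator A
  have h := congrArg projEta (hΩ.brst_brst (inclEta w))
  rw [hΩ.projEta_brst, hΩ.projEta_brst, projEta_inclEta, map_zero] at h
  have h' := sPrime_extInvolute A (extInvolute _ w)
  rw [extInvolute_extInvolute] at h'
  rw [h', map_neg, h, neg_zero]

theorem inclEta_mem_bidegree {l : ℕ} {w : EtaAlg n} (hw : w ∈ ⋀[ℂ]^l (Fin n → ℂ)) :
    inclEta w ∈ bidegree (n := n) 0 l := by
  induction hw using Submodule.pow_induction_on_left' with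
  | algebraMap r =>
    rw [AlgHom.commutes]
    exact ofPoly_mem_bidegree (MvPolynomial.C r)
  | add x y i hx hy ihx ihy => rw [map_add]; exact Submodule.add_mem _ ihx ihy
  | mem_mul m hm i x hx ih =>
    obtain ⟨v, rfl⟩ := hm
    rw [ι_eq_sum_eta, map_mul, map_sum, Finset.sum_mul]
    refine Submodule.sum_mem _ fun a _ => ?_
    rw [map_smul, inclEta_eta, smul_mul_assoc]
    exact Submodule.smul_mem _ _ (ghost_mul_mem_bidegree a ih)

theorem eta_mul_mem_exteriorPower (a : Fin n) {l : ℕ} {w : EtaAlg n}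
    (hw : w ∈ ⋀[ℂ]^l (Fin n → ℂ)) : eta a * w ∈ ⋀[ℂ]^(l + 1) (Fin n → ℂ) := by
  rw [ExteriorAlgebra.exteriorPower, pow_succ']
  exact Submodule.mul_mem_mul ⟨_, rfl⟩ hw

theorem projEta_mem_exteriorPower {l : ℕ} {x : ExtAlg n} (hx : x ∈ bidegree (n := n) 0 l) :
    projEta x ∈ ⋀[ℂ]^l (Fin n → ℂ) := by
  have h : ∀ {k l : ℕ} {x : ExtAlg n}, x ∈ bidegree (n := n) k l → k = 0 →
      projEta x ∈ ⋀[ℂ]^l (Fin n → ℂ) := by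
    intro k l x hx hk
    induction hx using bidegree_induction with
    | h₀ f =>
      rw [projEta_ofPoly, ExteriorAlgebra.exteriorPower, pow_zero]
      exact Submodule.algebraMap_mem _
    | h_add k l x y _ _ hx hy => rw [map_add]; exact Submodule.add_mem _ (hx hk) (hy hk)
    | h_mom k l x a _ hx => simp at hk
    | h_ghost l x a _ hx =>
      rw [map_mul, projEta_ghost]
      exact eta_mul_mem_exteriorPower a (hx hk)
    | h_zero k l => simp
  exact h hx rfl

theorem mem_etaGhostNumber_of_mem {l : ℕ} {g : ℤ} (hg : (l : ℤ) = g) :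
    ⋀[ℂ]^l (Fin n → ℂ) ≤ etaGhostNumber (n := n) g :=
  le_iSup_of_le l (le_iSup_of_le hg le_rfl)

theorem inclEta_mem_ghostNumber {g : ℤ} {w : EtaAlg n} (hw : w ∈ etaGhostNumber (n := n) g) :
    inclEta w ∈ ghostNumber (n := n) g := by
  have h : etaGhostNumber (n := n) g ≤ (ghostNumber g).comap inclEta.toLinearMap :=
    iSup_le fun l => iSup_le fun hl w hw =>
      bidegree_le_ghostNumber (by simpa using hl) (inclEta_mem_bidegree hw)
  exact h hw

theorem projEta_mem_etaGhostNumber {g : ℤ} {x : ExtAlg n} (hx : x ∈ ghostNumber (n := n) g) :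
    projEta x ∈ etaGhostNumber (n := n) g := by
  have h : ghostNumber (n := n) g ≤ (etaGhostNumber g).comap projEta.toLinearMap :=
    ghostNumber_le fun k l hkl x hx => by
      rw [Submodule.mem_comap, AlgHom.toLinearMap_apply]
      cases k with
      | zero => exact mem_etaGhostNumber_of_mem (by simpa using hkl) (projEta_mem_exteriorPower hx)
      | succ k =>
        rw [projEta_of_mem_antighostGE_one (bidegree_le_antighostGE l (Nat.le_add_left 1 k) hx)]
        exact Submodule.zero_mem _
  exact h hx

/-- A linear map that induces a bijection on cohomology classes induces an isomorphism of
cohomologies. -/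
theorem exists_cohomology_equiv {V U : Type*} [AddCommGroup V] [Module ℂ V] [AddCommGroup U]
    [Module ℂ U] {s : V →ₗ[ℂ] V} {d : U →ₗ[ℂ] U} (f : V →ₗ[ℂ] U)
    (hker : ∀ x, s x = 0 → d (f x) = 0) (hrange : ∀ x, f (s x) ∈ LinearMap.range d)
    (hsurj : ∀ w, d w = 0 → ∃ x, s x = 0 ∧ f x = w)
    (hinj : ∀ x, s x = 0 → f x ∈ LinearMap.range d → x ∈ LinearMap.range s) :
    ∃ e : Cohomology s ≃ₗ[ℂ] Cohomology d, ∀ x : LinearMap.ker s,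
      e (Submodule.Quotient.mk x) = Submodule.Quotient.mk ⟨f x, hker x x.2⟩ := by
  let F : LinearMap.ker s →ₗ[ℂ] LinearMap.ker d := f.restrict fun x hx => hker x hx
  let Φ : Cohomology s →ₗ[ℂ] Cohomology d := Submodule.mapQ _ _ F (by
    rintro ⟨_, hx⟩ ⟨y, rfl⟩
    exact hrange y)
  have hΦ : ∀ x, Φ (Submodule.Quotient.mk x) = Submodule.Quotient.mk (F x) := fun _ => rfl
  refine ⟨LinearEquiv.ofBijective Φ ⟨?_, ?_⟩, fun x => rfl⟩
  · rw [← LinearMap.ker_eq_bot, eq_bot_iff]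
    intro c hc
    obtain ⟨x, rfl⟩ := Submodule.Quotient.mk_surjective _ c
    rw [LinearMap.mem_ker, hΦ, Submodule.Quotient.mk_eq_zero] at hc
    rw [Submodule.mem_bot, Submodule.Quotient.mk_eq_zero]
    exact hinj x x.2 hc
  · intro c
    obtain ⟨⟨w, hw⟩, rfl⟩ := Submodule.Quotient.mk_surjective _ c
    obtain ⟨x, hx, rfl⟩ := hsurj w hw
    exact ⟨Submodule.Quotient.mk ⟨x, hx⟩, rfl⟩

variable {A} in
/-- The isomorphism induced by `π`. -/
theorem IsBRSTGenerator.exists_equiv {Ω : ExtAlg n}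
    (hΩ : IsBRSTGenerator A Ω) :
    ∃ e : Cohomology (brst A Ω) ≃ₗ[ℂ] Cohomology (sPrime A), ∀ g : ℤ,
      (cohomologyIn (brst A Ω) (ghostNumber g)).map e.toLinearMap
        = cohomologyIn (sPrime A) (etaGhostNumber g) := by
  have hker : ∀ x, brst A Ω x = 0 → sPrime A (projEta x) = 0 := fun x hx => by
    have h := hΩ.projEta_brst x
    rw [hx, map_zero, sPrime_extInvolute, eq_comm, neg_eq_zero] at h
    rw [← extInvolute_extInvolute (sPrime A _), h, map_zero]
  obtain ⟨e, he⟩ := exists_cohomology_equiv (s := brst A Ω) (d := sPrime A) projEta.toLinearMap hker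
    (fun x => ⟨_, (hΩ.projEta_brst x).symm⟩)
    (fun w hw => by
      obtain ⟨x, -, hx, hx'⟩ := hΩ.exists_lift (N := ⊤) (N' := ⊤) (by simp) (by simp) (by simp)
        (by simp) hw trivial
      exact ⟨x, hx', hx⟩)
    (by
      rintro x hx ⟨v, hv⟩
      rw [AlgHom.toLinearMap_apply] at hv
      have h : projEta (x - brst A Ω (inclEta (extInvolute _ v))) = 0 := by
        rw [map_sub, hΩ.projEta_brst, projEta_inclEta, extInvolute_extInvolute, hv, sub_self]
      obtain ⟨y, -, -, hy⟩ := hΩ.exists_primitive (N := ⊤) (N' := ⊤) (by simp) (by simp) (by simp)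
        (by simp) trivial h (by rw [map_sub, hx, hΩ.brst_brst, sub_zero])
      exact ⟨y + inclEta (extInvolute _ v), by rw [map_add, hy, sub_add_cancel]⟩)
  refine ⟨e, fun g => le_antisymm ?_ ?_⟩
  · rintro _ ⟨_, ⟨x, hx, rfl⟩, rfl⟩
    exact ⟨⟨projEta x, hker x x.2⟩, projEta_mem_etaGhostNumber hx, (he x).symm⟩
  · rintro _ ⟨⟨w, hw⟩, hwg, rfl⟩
    obtain ⟨x, hxg, rfl, hx⟩ := hΩ.exists_lift (N := ghostNumber (g + 1)) (N' := ghostNumber g)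
      (fun x hx => euler_mem_ghostNumber hx)
      (fun x hx => by
        have h := koszulHomotopy_mem_ghostNumber hx
        rwa [add_sub_cancel_right] at h)
      (fun x hx => parity_mem_ghostNumber hx) (fun x hx => hΩ.brst_mem_ghostNumber hx) hw
      (inclEta_mem_ghostNumber hwg)
    exact ⟨_, ⟨⟨x, hx⟩, hxg, rfl⟩, he ⟨x, hx⟩⟩

/-! ### Alternating forms from the exterior algebra -/

section AltForm

variable {L : Type*} [AddCommGroup L] [Module ℂ L] (D : L →ₗ[ℂ] Module.Dual ℂ (Fin n → ℂ))

theorem extContract_extContract (d : Module.Dual ℂ (Fin n → ℂ)) (x : EtaAlg n) :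
    extContract d (extContract d x) = 0 := CliffordAlgebra.contractLeft_contractLeft d x

theorem extContract_comm (d d' : Module.Dual ℂ (Fin n → ℂ)) (x : EtaAlg n) :
    extContract d (extContract d' x) = -extContract d' (extContract d x) :=
  CliffordAlgebra.contractLeft_comm d d' x

/-- The contraction with `D v` as a bilinear map. -/
noncomputable def contractBilin : EtaAlg n →ₗ[ℂ] L →ₗ[ℂ] EtaAlg n :=
  ((CliffordAlgebra.contractLeft (Q := (0 : QuadraticForm ℂ (Fin n → ℂ)))) ∘ₗ D).flip

/-- The multilinear form `(v_0, …, v_{k-1}) ↦ i_{v_{k-1}} ⋯ i_{v_0} x`, projected to its scalar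
component. -/
noncomputable def multilinearForm :
    (k : ℕ) → EtaAlg n →ₗ[ℂ] MultilinearMap ℂ (fun _ : Fin k => L) ℂ
  | 0 =>
    { toFun := fun x => MultilinearMap.constOfIsEmpty ℂ _ (ExteriorAlgebra.algebraMapInv x)
      map_add' := fun x y => by ext; simp
      map_smul' := fun c x => by ext; simp }
  | k + 1 =>
    { toFun := fun x => (multilinearForm k ∘ₗ contractBilin D x).uncurryLeft
      map_add' := fun x y => by ext; simp
      map_smul' := fun c x => by ext; simp }

theorem multilinearForm_succ (k : ℕ) (x : EtaAlg n) (v : Fin (k + 1) → L) :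
    multilinearForm D (k + 1) x v
      = multilinearForm D k (extContract (D (v 0)) x) (Fin.tail v) := rfl

theorem multilinearForm_eq_zero_of_contract {k : ℕ} {x : EtaAlg n} {v : Fin k → L} {i : Fin k}
    (hi : extContract (D (v i)) x = 0) : multilinearForm D k x v = 0 := by
  induction k generalizing x with
  | zero => exact i.elim0
  | succ k ih =>
    rw [multilinearForm_succ]
    cases i using Fin.cases with
    | zero => rw [hi, map_zero, _root_.zero_apply]
    | succ i => exact ih (i := i) (by rw [Fin.tail, extContract_comm, hi, map_zero, neg_zero])

theorem multilinearForm_eq_zero_of_eq {k : ℕ} {x : EtaAlg n} {v : Fin k → L} {i j : Fin k}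
    (hv : v i = v j) (hij : i < j) : multilinearForm D k x v = 0 := by
  induction k generalizing x with
  | zero => exact i.elim0
  | succ k ih =>
    rw [multilinearForm_succ]
    cases j using Fin.cases with
    | zero => exact absurd hij (Fin.not_lt_zero _)
    | succ j =>
      cases i using Fin.cases with
      | zero =>
        refine multilinearForm_eq_zero_of_contract D (i := j) ?_
        rw [Fin.tail, ← hv, extContract_extContract]
      | succ i => exact ih (i := i) (j := j) hv (Fin.succ_lt_succ_iff.1 hij)

/-- The alternating form `(v_0, …, v_{k-1}) ↦ i_{v_{k-1}} ⋯ i_{v_0} x` attached to an element `x` of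
`ℂ(η^a)`. -/
noncomputable def altForm (k : ℕ) : EtaAlg n →ₗ[ℂ] L [⋀^Fin k]→ₗ[ℂ] ℂ where
  toFun x :=
    { multilinearForm D k x with
      map_eq_zero_of_eq' := fun v i j hv hij => by
        rcases lt_or_gt_of_ne hij with h | h
        · exact multilinearForm_eq_zero_of_eq D hv h
        · exact multilinearForm_eq_zero_of_eq D hv.symm h }
  map_add' x y := by
    ext v
    exact congrArg (fun f => f v) (map_add (multilinearForm D k) x y)
  map_smul' c x := by
    ext v
    exact congrArg (fun f => f v) (map_smul (multilinearForm D k) c x)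

theorem altForm_zero_apply (x : EtaAlg n) (v : Fin 0 → L) :
    altForm D 0 x v = ExteriorAlgebra.algebraMapInv x := rfl

theorem altForm_succ_apply (k : ℕ) (x : EtaAlg n) (v : Fin (k + 1) → L) :
    altForm D (k + 1) x v = altForm D k (extContract (D (v 0)) x) (Fin.tail v) := rfl

theorem altForm_curryLeft (k : ℕ) (x : EtaAlg n) (v : L) :
    (altForm D (k + 1) x).curryLeft v = altForm D k (extContract (D v) x) := rfl

theorem algebraMapInv_ι_mul (w : Fin n → ℂ) (x : EtaAlg n) :
    ExteriorAlgebra.algebraMapInv (ExteriorAlgebra.ι ℂ w * x) = 0 := by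
  rw [map_mul, ExteriorAlgebra.algebraMapInv, ExteriorAlgebra.lift_ι_apply]
  simp

theorem altForm_ι_mul_apply (k : ℕ) (w : Fin n → ℂ) (x : EtaAlg n) (v : Fin (k + 1) → L) :
    altForm D (k + 1) (ExteriorAlgebra.ι ℂ w * x) v
      = ∑ i : Fin (k + 1), (-1 : ℂ) ^ (i : ℕ) * (D (v i) w * altForm D k x (i.removeNth v)) := by
  induction k generalizing x with
  | zero =>
    rw [altForm_succ_apply, extContract_ι_mul, map_sub, AlternatingMap.sub_apply,
      altForm_zero_apply _ (_ * _), algebraMapInv_ι_mul]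
    simp [altForm_zero_apply]
  | succ k ih =>
    rw [altForm_succ_apply, extContract_ι_mul, map_sub, AlternatingMap.sub_apply, ih, map_smul,
      Fin.sum_univ_succ (n := k + 1), sub_eq_add_neg, ← Finset.sum_neg_distrib]
    congr 1
    · simp [Fin.removeNth_zero]
    · refine Finset.sum_congr rfl fun i _ => ?_
      rw [altForm_succ_apply D k x]
      have h₁ : (i.succ.removeNth v) 0 = v 0 := rfl
      have h₂ : Fin.tail (i.succ.removeNth v) = i.removeNth (Fin.tail v) := by
        funext j
        simp [Fin.tail, Fin.removeNth]
      rw [h₁, h₂, Fin.tail, Fin.val_succ, pow_succ]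
      ring

/-- Multiplication by a linear element is an antisymmetrization. -/
theorem altForm_ι_mul (k : ℕ) (w : Fin n → ℂ) (x : EtaAlg n) :
    altForm D (k + 1) (ExteriorAlgebra.ι ℂ w * x)
      = AlternatingMap.alternatizeUncurryFinLM
        ((LinearMap.applyₗ w ∘ₗ D).smulRight (altForm D k x)) := by
  ext v
  rw [altForm_ι_mul_apply, AlternatingMap.alternatizeUncurryFinLM_apply,
    AlternatingMap.alternatizeUncurryFin_apply]
  refine Finset.sum_congr rfl fun i _ => ?_
  simp

theorem extContract_mem_exteriorPower (d : Module.Dual ℂ (Fin n → ℂ)) {k : ℕ} {x : EtaAlg n}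
    (hx : x ∈ ⋀[ℂ]^k (Fin n → ℂ)) :
    (k = 0 → extContract d x = 0) ∧ ∀ m, k = m + 1 → extContract d x ∈ ⋀[ℂ]^m (Fin n → ℂ) := by
  induction hx using Submodule.pow_induction_on_left' with
  | algebraMap r =>
    refine ⟨fun _ => ?_, by simp⟩
    rw [Algebra.algebraMap_eq_smul_one, map_smul, extContract_one, smul_zero]
  | add x y i hx hy ihx ihy =>
    refine ⟨fun h => by rw [map_add, ihx.1 h, ihy.1 h, add_zero], fun m hm => ?_⟩
    rw [map_add]
    exact Submodule.add_mem _ (ihx.2 m hm) (ihy.2 m hm)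
  | mem_mul v hv i x hx ih =>
    obtain ⟨v, rfl⟩ := hv
    refine ⟨by simp, fun m hm => ?_⟩
    obtain rfl : i = m := by simpa using hm
    rw [extContract_ι_mul]
    refine Submodule.sub_mem _ (Submodule.smul_mem _ _ hx) ?_
    cases i with
    | zero => rw [ih.1 rfl, mul_zero]; exact Submodule.zero_mem _
    | succ i =>
      rw [ExteriorAlgebra.exteriorPower, pow_succ']
      exact Submodule.mul_mem_mul ⟨_, rfl⟩ (ih.2 i rfl)

/-- Euler's formula on the exterior algebra. -/
theorem sum_eta_mul_extContract {k : ℕ} {x : EtaAlg n} (hx : x ∈ ⋀[ℂ]^k (Fin n → ℂ)) :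
    ∑ a, eta a * extContract (LinearMap.proj a) x = (k : ℂ) • x := by
  induction hx using Submodule.pow_induction_on_left' with
  | algebraMap r =>
    simp only [Algebra.algebraMap_eq_smul_one, map_smul, extContract_one, smul_zero, mul_zero,
      Finset.sum_const_zero, Nat.cast_zero, zero_smul]
  | add x y i hx hy ihx ihy =>
    simp only [map_add, mul_add, Finset.sum_add_distrib, ihx, ihy, smul_add]
  | mem_mul v hv i x hx ih =>
    obtain ⟨v, rfl⟩ := hv
    have h : ∀ a, eta a * extContract (LinearMap.proj a) (ExteriorAlgebra.ι ℂ v * x)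
        = (v a • eta a) * x
          + ExteriorAlgebra.ι ℂ v * (eta a * extContract (LinearMap.proj a) x) := fun a => by
      have h' : eta a * (ExteriorAlgebra.ι ℂ v * extContract (LinearMap.proj a) x)
          = -(ExteriorAlgebra.ι ℂ v * (eta a * extContract (LinearMap.proj a) x)) := by
        rw [← mul_assoc, ← mul_assoc, ← neg_mul]
        congr 1
        exact eq_neg_of_add_eq_zero_left (ExteriorAlgebra.ι_add_mul_swap _ _)
      rw [extContract_ι_mul, mul_sub, h', LinearMap.proj_apply, mul_smul_comm, smul_mul_assoc,
        sub_neg_eq_add]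
    rw [Finset.sum_congr rfl fun a _ => h a, Finset.sum_add_distrib, ← Finset.sum_mul,
      ← ι_eq_sum_eta, ← Finset.mul_sum, ih, mul_smul_comm]
    push_cast
    module

/-- Contractions of `x` with all vectors vanish by induction, so `x` vanishes by Euler's formula. -/
theorem eq_zero_of_altForm_eq_zero (hD : Function.Surjective D) {k : ℕ} {x : EtaAlg n}
    (hx : x ∈ ⋀[ℂ]^k (Fin n → ℂ)) (h : altForm D k x = 0) : x = 0 := by
  induction k generalizing x with
  | zero =>
    rw [ExteriorAlgebra.exteriorPower, pow_zero, Submodule.mem_one] at hx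
    obtain ⟨r, rfl⟩ := hx
    have h' : altForm D 0 (algebraMap ℂ _ r) 0 = 0 := by rw [h]; rfl
    rw [altForm_zero_apply, ExteriorAlgebra.algebraMap_leftInverse] at h'
    rw [h', map_zero]
  | succ k ih =>
    have hc : ∀ a : Fin n, extContract (LinearMap.proj a) x = 0 := fun a => by
      obtain ⟨v, hv⟩ := hD (LinearMap.proj a)
      rw [← hv]
      refine ih ((extContract_mem_exteriorPower _ hx).2 k rfl) ?_
      rw [← altForm_curryLeft, h]
      rfl
    have h' := sum_eta_mul_extContract hx
    simp only [hc, mul_zero, Finset.sum_const_zero] at h'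
    exact (smul_eq_zero.mp h'.symm).resolve_left (by exact_mod_cast Nat.succ_ne_zero k)

/-- Surjectivity of `altForm` in degree `k`, by injectivity and equality of dimensions. -/
theorem exists_altForm_eq (hD : Function.Bijective D) (k : ℕ) (ω : L [⋀^Fin k]→ₗ[ℂ] ℂ) :
    ∃ x ∈ ⋀[ℂ]^k (Fin n → ℂ), altForm D k x = ω := by
  let E : L ≃ₗ[ℂ] Module.Dual ℂ (Fin n → ℂ) := LinearEquiv.ofBijective D hD
  have : Module.Finite ℂ L := Module.Finite.equiv E.symm
  have hL : Module.finrank ℂ L = Module.finrank ℂ (Fin n → ℂ) := by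
    rw [E.finrank_eq, Subspace.dual_finrank_eq]
  let T : (L [⋀^Fin k]→ₗ[ℂ] ℂ) ≃ₗ[ℂ] Module.Dual ℂ (⋀[ℂ]^k L) :=
    exteriorPower.alternatingMapLinearEquiv
  have : Module.Finite ℂ (L [⋀^Fin k]→ₗ[ℂ] ℂ) := Module.Finite.equiv T.symm
  let Φ : ⋀[ℂ]^k (Fin n → ℂ) →ₗ[ℂ] L [⋀^Fin k]→ₗ[ℂ] ℂ := altForm D k ∘ₗ Submodule.subtype _
  have hinj : Function.Injective Φ := by
    rw [← LinearMap.ker_eq_bot, eq_bot_iff]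
    intro x hx
    exact Subtype.ext (eq_zero_of_altForm_eq_zero D hD.2 x.2 hx)
  have hrank : Module.finrank ℂ (⋀[ℂ]^k (Fin n → ℂ))
      = Module.finrank ℂ (L [⋀^Fin k]→ₗ[ℂ] ℂ) := by
    rw [T.finrank_eq, Subspace.dual_finrank_eq, exteriorPower.finrank_eq, exteriorPower.finrank_eq,
      hL]
  obtain ⟨x, hx⟩ := (LinearMap.injective_iff_surjective_of_finrank_eq_finrank hrank).1 hinj ω
  exact ⟨x, x.2, hx⟩

end AltForm

/-! ### Comparison with the Chevalley–Eilenberg complex -/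

/-- The identification of the underlying Lie algebra with the dual of the span of the `η^a`. -/
noncomputable def lieToDual : A.UnderlyingLie →ₗ[ℂ] Module.Dual ℂ (Fin n → ℂ) where
  toFun v := ∑ a, v a • LinearMap.proj a
  map_add' v w := by
    rw [← Finset.sum_add_distrib]
    exact Finset.sum_congr rfl fun a _ => add_smul (v a) (w a) _
  map_smul' c v := by
    rw [Finset.smul_sum]
    exact Finset.sum_congr rfl fun a _ => mul_smul c (v a) _

theorem lieToDual_apply (v : A.UnderlyingLie) :
    lieToDual A v = ∑ a, v a • LinearMap.proj a := rfl

theorem lieToDual_single (v : A.UnderlyingLie) (b : Fin n) :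
    lieToDual A v (Pi.single b 1) = v b := by
  rw [lieToDual_apply, LinearMap.sum_apply, Finset.sum_eq_single b]
  · simp
  · intro a _ ha
    simp [Pi.single_eq_of_ne ha]
  · simp

theorem extContract_lieToDual (v : A.UnderlyingLie) (x : EtaAlg n) :
    extContract (lieToDual A v) x = ∑ a, v a • extContract (LinearMap.proj a) x := by
  rw [lieToDual_apply, extContract, map_sum, LinearMap.sum_apply]
  refine Finset.sum_congr rfl fun a _ => ?_
  rw [map_smul, LinearMap.smul_apply]

theorem lieToDual_bijective : Function.Bijective (lieToDual A) := by
  constructor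
  · intro v w h
    funext b
    have hv := lieToDual_single A v b
    rw [h] at hv
    exact hv.symm.trans (lieToDual_single A w b)
  · intro d
    refine ⟨fun b => d (Pi.single b 1), ?_⟩
    refine LinearMap.pi_ext' fun b => LinearMap.ext_ring ?_
    exact lieToDual_single A _ b

theorem sPrime_mem_exteriorPower {k : ℕ} {x : EtaAlg n} (hx : x ∈ ⋀[ℂ]^k (Fin n → ℂ)) :
    sPrime A x ∈ ⋀[ℂ]^(k + 1) (Fin n → ℂ) := by
  rw [sPrime_apply]
  refine Submodule.sum_mem _ fun a _ => Submodule.sum_mem _ fun b _ =>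
    Submodule.sum_mem _ fun c _ => Submodule.smul_mem _ _ ?_
  have h := extContract_mem_exteriorPower (LinearMap.proj a) hx
  cases k with
  | zero => rw [h.1 rfl, mul_zero]; exact Submodule.zero_mem _
  | succ k =>
    rw [mul_assoc]
    exact eta_mul_mem_exteriorPower b (eta_mul_mem_exteriorPower c (h.2 k rfl))

/-- The form attached to `s' x` is, up to a sign, the Chevalley–Eilenberg differential of the form
attached to `x`. -/
theorem altForm_sPrime (k : ℕ) (x : EtaAlg n) :
    altForm (lieToDual A) (k + 1) (sPrime A x)
      = -ceDiff k (altForm (lieToDual A) k x) := by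
  cases k with
  | zero =>
    rw [show ceDiff (L := A.UnderlyingLie) 0 = 0 from rfl, LinearMap.zero_apply, neg_zero,
      sPrime_apply]
    simp only [map_sum, map_smul]
    refine Finset.sum_eq_zero fun a _ => Finset.sum_eq_zero fun b _ =>
      Finset.sum_eq_zero fun c _ => ?_
    ext v
    rw [mul_assoc, eta, eta, AlternatingMap.smul_apply, altForm_ι_mul_apply]
    simp only [altForm_zero_apply, algebraMapInv_ι_mul, mul_zero, Finset.sum_const_zero, smul_zero]
    rfl
  | succ k =>
    have hce : ceDiff (k + 1) (altForm (lieToDual A) (k + 1) x) = (-(1 / 2) : ℂ) •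
        AlternatingMap.alternatizeUncurryFinLM (AlternatingMap.alternatizeUncurryFinLM ∘ₗ
          LinearMap.compr₂ lieBilin (altForm (lieToDual A) (k + 1) x).curryLeft) := rfl
    have hcomp : LinearMap.compr₂ lieBilin (altForm (lieToDual A) (k + 1) x).curryLeft
        = ∑ a, ∑ b, ∑ c, A.structConst a b c •
          (LinearMap.applyₗ (Pi.single b 1) ∘ₗ lieToDual A).smulRight
            ((LinearMap.applyₗ (Pi.single c 1) ∘ₗ lieToDual A).smulRight
              (altForm (lieToDual A) k (extContract (LinearMap.proj a) x))) := by
      refine LinearMap.ext fun v => LinearMap.ext fun w => ?_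
      have hl : LinearMap.compr₂ lieBilin (altForm (lieToDual A) (k + 1) x).curryLeft v w
          = altForm (lieToDual A) k (extContract (lieToDual A ⁅v, w⁆) x) := rfl
      rw [hl, extContract_lieToDual]
      simp only [map_sum, map_smul, LinearMap.sum_apply, LinearMap.smul_apply,
        LinearMap.smulRight_apply, LinearMap.comp_apply, LinearMap.applyₗ_apply_apply,
        lieToDual_single]
      refine Finset.sum_congr rfl fun a _ => ?_
      rw [A.lie_apply, Finset.sum_smul]
      refine Finset.sum_congr rfl fun b _ => ?_
      rw [Finset.sum_smul]
      refine Finset.sum_congr rfl fun c _ => ?_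
      rw [smul_smul, smul_smul, mul_assoc]
    have hη : ∀ (m : ℕ) (b : Fin n) (y : EtaAlg n), altForm (lieToDual A) (m + 1) (eta b * y)
        = AlternatingMap.alternatizeUncurryFinLM
          ((LinearMap.applyₗ (Pi.single b 1) ∘ₗ lieToDual A).smulRight
            (altForm (lieToDual A) m y)) := fun m b y => altForm_ι_mul _ _ _ _
    rw [hce, hcomp, sPrime_apply, ← neg_smul, neg_neg]
    have hLM : AlternatingMap.alternatizeUncurryFinLM ∘ₗ (∑ a, ∑ b, ∑ c, A.structConst a b c •
          (LinearMap.applyₗ (Pi.single b 1) ∘ₗ lieToDual A).smulRight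
            ((LinearMap.applyₗ (Pi.single c 1) ∘ₗ lieToDual A).smulRight
              (altForm (lieToDual A) k (extContract (LinearMap.proj a) x))))
        = ∑ a, ∑ b, ∑ c, A.structConst a b c •
          (LinearMap.applyₗ (Pi.single b 1) ∘ₗ lieToDual A).smulRight
            (AlternatingMap.alternatizeUncurryFinLM
              ((LinearMap.applyₗ (Pi.single c 1) ∘ₗ lieToDual A).smulRight
                (altForm (lieToDual A) k (extContract (LinearMap.proj a) x)))) :=
      LinearMap.ext fun v => by
        simp only [LinearMap.comp_apply, LinearMap.sum_apply, LinearMap.smul_apply,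
          LinearMap.smulRight_apply, map_sum, map_smul]
    rw [hLM]
    simp only [map_sum, map_smul, Finset.smul_sum, mul_smul, mul_assoc (eta _), hη]

theorem mem_etaGhostNumber_natCast {k : ℕ} {x : EtaAlg n} :
    x ∈ etaGhostNumber (n := n) (k : ℤ) ↔ x ∈ ⋀[ℂ]^k (Fin n → ℂ) := by
  refine ⟨fun h => ?_, fun h => mem_etaGhostNumber_of_mem rfl h⟩
  have h' : etaGhostNumber (n := n) (k : ℤ) ≤ ⋀[ℂ]^k (Fin n → ℂ) :=
    iSup_le fun l => iSup_le fun hl => by rw [Nat.cast_injective hl]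
  exact h' h

theorem altForm_mem_ker_iff {k : ℕ} {x : EtaAlg n} (hx : x ∈ ⋀[ℂ]^k (Fin n → ℂ)) :
    ceDiff k (altForm (lieToDual A) k x) = 0 ↔ sPrime A x = 0 := by
  rw [← neg_eq_zero, ← altForm_sPrime]
  exact ⟨eq_zero_of_altForm_eq_zero _ (lieToDual_bijective A).2 (sPrime_mem_exteriorPower A hx),
    fun h => by rw [h, map_zero]⟩

theorem altForm_mem_ceCoboundaries_iff {k : ℕ} {x : EtaAlg n} (hx : x ∈ ⋀[ℂ]^k (Fin n → ℂ)) :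
    altForm (lieToDual A) k x ∈ ceCoboundaries (L := A.UnderlyingLie) k
      ↔ x ∈ LinearMap.range (sPrime A) := by
  have hD := lieToDual_bijective A
  cases k with
  | zero =>
    change altForm (lieToDual A) 0 x ∈ (⊥ : Submodule ℂ _) ↔ _
    rw [Submodule.mem_bot]
    constructor
    · intro h
      rw [eq_zero_of_altForm_eq_zero _ hD.2 hx h]
      exact Submodule.zero_mem _
    · rintro ⟨y, rfl⟩
      ext v
      rw [altForm_zero_apply, sPrime_apply]
      simp only [map_sum, map_smul, mul_assoc (eta _)]
      refine Finset.sum_eq_zero fun a _ => Finset.sum_eq_zero fun b _ =>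
        Finset.sum_eq_zero fun c _ => ?_
      rw [eta, algebraMapInv_ι_mul, smul_zero]
  | succ k =>
    change altForm (lieToDual A) (k + 1) x ∈ LinearMap.range (ceDiff k) ↔ _
    constructor
    · rintro ⟨ω, hω⟩
      obtain ⟨y, hy, rfl⟩ := exists_altForm_eq _ hD k ω
      refine ⟨-y, ?_⟩
      have h : x + sPrime A y = 0 := by
        refine eq_zero_of_altForm_eq_zero _ hD.2
          (Submodule.add_mem _ hx (sPrime_mem_exteriorPower A hy)) ?_
        rw [map_add, altForm_sPrime, hω, add_neg_cancel]
      rw [map_neg, eq_comm]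
      exact eq_neg_of_add_eq_zero_left h
    · rintro ⟨y, rfl⟩
      exact ⟨-altForm (lieToDual A) k y, by rw [map_neg, altForm_sPrime]⟩

theorem nonempty_equiv_CECohomology {V U L : Type*} [AddCommGroup V] [Module ℂ V]
    [AddCommGroup U] [Module ℂ U] [LieRing L] [LieAlgebra ℂ L] {k : ℕ} (f : V →ₗ[ℂ] U)
    (r : V →ₗ[ℂ] L [⋀^Fin k]→ₗ[ℂ] ℂ) (hf : Function.Surjective f)
    (hr : LinearMap.range r = LinearMap.ker (ceDiff k))
    (h : ∀ v, f v = 0 ↔ r v ∈ ceCoboundaries k) : Nonempty (U ≃ₗ[ℂ] CECohomology L k) := by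
  let r' : V →ₗ[ℂ] LinearMap.ker (ceDiff (L := L) k) :=
    r.codRestrict _ fun v => hr ▸ LinearMap.mem_range_self r v
  let g := ((ceCoboundaries (L := L) k).submoduleOf (LinearMap.ker (ceDiff k))).mkQ ∘ₗ r'
  have hg : Function.Surjective g := by
    intro c
    obtain ⟨⟨ω, hω⟩, rfl⟩ := Submodule.Quotient.mk_surjective _ c
    rw [← hr] at hω
    obtain ⟨v, rfl⟩ := hω
    exact ⟨v, rfl⟩
  have hfg : LinearMap.ker f = LinearMap.ker g := by
    ext v
    rw [LinearMap.mem_ker, h]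
    exact (Submodule.Quotient.mk_eq_zero
      ((ceCoboundaries (L := L) k).submoduleOf (LinearMap.ker (ceDiff k))) (x := r' v)).symm
  exact ⟨(f.quotKerEquivOfSurjective hf).symm ≪≫ₗ Submodule.quotEquivOfEq _ _ hfg ≪≫ₗ
    g.quotKerEquivOfSurjective hg⟩

/-- Both cohomologies are quotients of the space of cocycles of degree `k` of `s'`. -/
theorem nonempty_cohomologyIn_equiv_CECohomology (k : ℕ) :
    Nonempty (cohomologyIn (sPrime A) (etaGhostNumber (k : ℤ)) ≃ₗ[ℂ]
      CECohomology A.UnderlyingLie k) := by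
  let Z : Submodule ℂ (LinearMap.ker (sPrime A)) :=
    (etaGhostNumber (k : ℤ)).submoduleOf (LinearMap.ker (sPrime A))
  have hZ : ∀ z : Z, ((z : LinearMap.ker (sPrime A)) : EtaAlg n) ∈ ⋀[ℂ]^k (Fin n → ℂ) :=
    fun z => mem_etaGhostNumber_natCast.1 z.2
  let q := ((LinearMap.range (sPrime A)).submoduleOf (LinearMap.ker (sPrime A))).mkQ
  let f : Z →ₗ[ℂ] cohomologyIn (sPrime A) (etaGhostNumber (k : ℤ)) :=
    q.restrict fun z hz => Submodule.mem_map_of_mem hz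
  let r : Z →ₗ[ℂ] A.UnderlyingLie [⋀^Fin k]→ₗ[ℂ] ℂ :=
    altForm (lieToDual A) k ∘ₗ Submodule.subtype _ ∘ₗ Submodule.subtype _
  have hf : Function.Surjective f := by
    rintro ⟨_, z, hz, rfl⟩
    exact ⟨⟨z, hz⟩, rfl⟩
  refine nonempty_equiv_CECohomology (V := Z)
    (U := cohomologyIn (sPrime A) (etaGhostNumber (k : ℤ))) f r hf
    (le_antisymm ?_ fun ω hω => ?_) fun z => ?_
  · rintro _ ⟨z, rfl⟩
    exact (altForm_mem_ker_iff A (hZ z)).2 z.1.2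
  · obtain ⟨x, hx, rfl⟩ := exists_altForm_eq _ (lieToDual_bijective A) k ω
    exact ⟨⟨⟨x, (altForm_mem_ker_iff A hx).1 hω⟩, mem_etaGhostNumber_natCast.2 hx⟩, rfl⟩
  · refine Iff.trans ?_ (altForm_mem_ceCoboundaries_iff A (hZ z)).symm
    rw [← Subtype.coe_inj]
    exact Submodule.Quotient.mk_eq_zero _

end PoissonBRST

theorem mainTheorem5 {n : ℕ} (A : PoissonBRST.FirstClassPoissonAlgebra n) :
    (∃ Ω : PoissonBRST.ExtAlg n, PoissonBRST.IsBRSTGenerator A Ω) ∧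
    PoissonBRST.sPrime A ∘ₗ PoissonBRST.sPrime A = 0 ∧
    (∀ Ω : PoissonBRST.ExtAlg n, PoissonBRST.IsBRSTGenerator A Ω →
      PoissonBRST.brst A Ω ∘ₗ PoissonBRST.brst A Ω = 0 ∧
      ∃ e : PoissonBRST.Cohomology (PoissonBRST.brst A Ω) ≃ₗ[ℂ]
          PoissonBRST.Cohomology (PoissonBRST.sPrime A),
        ∀ g : ℤ,
          (PoissonBRST.cohomologyIn (PoissonBRST.brst A Ω) (PoissonBRST.ghostNumber g)).map
              e.toLinearMap =
            PoissonBRST.cohomologyIn (PoissonBRST.sPrime A) (PoissonBRST.etaGhostNumber g)) ∧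
    (∀ k : ℕ,
      Nonempty (PoissonBRST.cohomologyIn (PoissonBRST.sPrime A)
          (PoissonBRST.etaGhostNumber (k : ℤ)) ≃ₗ[ℂ]
        PoissonBRST.CECohomology A.UnderlyingLie k)) :=
  ⟨PoissonBRST.exists_isBRSTGenerator A,
    LinearMap.ext fun w => PoissonBRST.sPrime_sPrime A w,
    fun _ hΩ => ⟨LinearMap.ext fun x => hΩ.brst_brst x, hΩ.exists_equiv⟩,
    fun k => PoissonBRST.nonempty_cohomologyIn_equiv_CECohomology A k⟩
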